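/- **Channel model.** A receiver-orthogonal relay channel has binary inputs $X$ (sender) and $X_1$ (relay) and discrete output alphabets. The input $X$ produces a pair $(Y',Y_1)$ with law $P_{Y'Y_1|X}$, where $Y'$ is observed by the destination and $Y_1$ by the relay; independently of this, $X_1$ produces $Y''$, observed by the destination, with law $P_{Y''|X_1}$. The channel is memoryless. Assume that it is physically degraded, $P_{Y'Y_1|X}=P_{Y_1|X}\,P_{Y'|Y_1}$ for some conditional distribution $P_{Y'|Y_1}$, and that the three channels SD $=P_{Y'|X}$, SR $=P_{Y_1|X}$ and RD $=P_{Y''|X_1}$ are symmetric (a binary-input channel $W$ is symmetric if there is an involution $\pi$ of its output alphabet with $W(y|1)=W(\pi(y)|0)$ for all $y$). Let $C_{SD},C_{SR},C_{RD}$ be their Shannon capacities $\sup_{p}I(\text{input};\text{output})$ in bits, and let $$C=\sup_{p(x)p(x_1)}\min\{I(X;Y')+I(X_1;Y''),\ I(X;Y',Y_1)\}.$$ **Polar codes.** Let $N=2^n$ and $G=R\,F^{\otimes n}$ over $\mathbb F_2$, where $F=\begin{pmatrix}1&0\\1&1\end{pmatrix}$ and $R$ is the bit-reversal permutation matrix.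 The polar code $P(N,\mathcal A)$ consists of the words $uG$ with $u_i=0$ for $i\notin\mathcal A$; for $\mathcal B\subseteq\mathcal A$, the nested polar code $P(N,\mathcal A,\mathcal B)$ is $P(N,\mathcal A)$ partitioned into cosets of $P(N,\mathcal B)$, the coset being determined by $u_{\mathcal A\setminus\mathcal B}$. Successive cancellation (SC) decoding for a channel $W$ with information set $\mathcal A$ computes $\hat u_1,\dots,\hat u_N$ in this order: for $i\notin\mathcal A$, $\hat u_i$ is the given frozen value; for $i\in\mathcal A$, $\hat u_i=0$ if $W_N^{(i)}(y,\hat u_1^{i-1}|0)\ge W_N^{(i)}(y,\hat u_1^{i-1}|1)$, and $\hat u_i=1$ otherwise, where $W_N^{(i)}(y,u_1^{i-1}|u_i)=2^{-(N-1)}\sum_{u_{i+1}^N}\prod_{j=1}^N W(y_j|(uG)_j)$. **Block-Markov scheme.** Given $\mathcal B\subseteq\mathcal A$, a set $\mathcal D$ and a bijection $\mathcal A\setminus\mathcal B\to\mathcal D$, transmission takes $B+1$ blocks of length $N$. In each of the first $B$ blocks the source sends the codeword of $P(N,\mathcal A,\mathcal B)$ that carries $|\mathcal A|$ fresh message bits,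 and in the last block the zero word. After each of the first $B$ blocks the relay decodes the bits in $\mathcal A$ from $Y_1^N$ by SC decoding for SR (zero frozen bits), and in the next block it sends its estimates of the bits in $\mathcal A\setminus\mathcal B$ with the polar code $P(N,\mathcal D)$, through the bijection; in the first block it sends the zero word. For each of the first $B$ blocks, the destination decodes the relay's bits from the $Y''^N$ of the next block by SC decoding for RD, which gives the bits in $\mathcal A\setminus\mathcal B$, and then decodes the bits in $\mathcal B$ from the $Y'^N$ of the block by SC decoding for SD with information set $\mathcal B$, the frozen bits in $\mathcal A\setminus\mathcal B$ being those just found and all other frozen bits being $0$. The rate of the scheme is $B|\mathcal A|/(N(B+1))$. **Theorem 2.** Under these assumptions $C=\min\{C_{SD}+C_{RD},\,C_{SR}\}$. Moreover, for every $R<C$ and every $\varepsilon>0$ there is $B_0$ such that for every $B\ge B_0$ there is $n_0$ such that for every $n\ge n_0$ there are sets $\mathcal B\subseteq\mathcal A$ and $\mathcal D$ and a bijection $\mathcal A\setminus\mathcal B\to\mathcal D$ for which the block-Markov scheme of total length $(B+1)2^n$ has rate at least $R$ and, for every message, the probability that the destination's estimate of the message (all $B|\mathcal A|$ bits) is wrong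 is smaller than $\varepsilon$. -/

import Mathlib

open scoped ENNReal

noncomputable section

namespace PolarRelay

/-! ### Binary-input discrete memoryless channels and mutual information -/

/-- A binary-input discrete memoryless channel: `W x y` is the probability of the output `y`
given the input bit `x`. -/
abbrev Channel (Y : Type*) := ZMod 2 → PMF Y

/-- Symmetry: some involution of the output alphabet exchanges the two output laws. -/
def Channel.IsSymmetric {Y : Type*} (W : Channel Y) : Prop :=
  ∃ π : Equiv.Perm Y, (∀ y, π (π y) = y) ∧ ∀ y, W 1 y = W 0 (π y)

/-- `I(X;Y)` in bits, for `X` distributed as `p` and `Y` the output of `W` with input `X`. -/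
def mutualInfo {Y : Type*} (p : PMF (ZMod 2)) (W : Channel Y) : ℝ :=
  ∑ x, ∑' y, (p x * W x y).toReal *
    Real.logb 2 ((W x y).toReal / ((p.bind W) y).toReal)

/-- The Shannon capacity in bits per channel use. -/
def Channel.capacity {Y : Type*} (W : Channel Y) : ℝ :=
  ⨆ p : PMF (ZMod 2), mutualInfo p W

/-! ### The polar transform and successive cancellation decoding -/

/-- The kernel `F = [[1, 0], [1, 1]]`, with rows and columns indexed by bits. -/
def kernelF (a b : Bool) : ZMod 2 := if a = false ∧ b = true then 0 else 1

/-- The Kronecker power `F^{⊗n}`: its entry at `(i, j)` is the product, over the `n` binary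
digits, of the entries of `F` at the digits of `i` and `j`. -/
def kronPow (n : ℕ) : Matrix (Fin (2 ^ n)) (Fin (2 ^ n)) (ZMod 2) :=
  Matrix.of fun i j => ∏ k : Fin n, kernelF (i.val.testBit k) (j.val.testBit k)

/-- Reversal of the `n` binary digits of an index. -/
def bitRev {n : ℕ} (i : Fin (2 ^ n)) : Fin (2 ^ n) :=
  Fin.ofBits fun k : Fin n => i.val.testBit k.rev

/-- `G = R F^{⊗n}`, with `R` the bit-reversal permutation of the rows. -/
def polarMatrix (n : ℕ) : Matrix (Fin (2 ^ n)) (Fin (2 ^ n)) (ZMod 2) :=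
  (kronPow n).submatrix bitRev id

/-- The codeword `x = u G`. -/
def polarEncode {n : ℕ} (u : Fin (2 ^ n) → ZMod 2) : Fin (2 ^ n) → ZMod 2 :=
  Matrix.vecMul u (polarMatrix n)

/-- The probability that independent uses of `W` with inputs `x` have outputs `y`. -/
def blockProb {n : ℕ} {Y : Type*} (W : Channel Y)
    (x : Fin (2 ^ n) → ZMod 2) (y : Fin (2 ^ n) → Y) : ℝ≥0∞ :=
  ∏ j, W (x j) (y j)

/-- The polarized channel `W_N^{(i)}(y, u_{<i} | b)`, where `N = 2 ^ n`; only the entries of `u`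
at indices below `i` are used. -/
def polarizedChannel {n : ℕ} {Y : Type*} (W : Channel Y) (i : Fin (2 ^ n))
    (y : Fin (2 ^ n) → Y) (u : Fin (2 ^ n) → ZMod 2) (b : ZMod 2) : ℝ≥0∞ :=
  ∑ v : Fin (2 ^ n) → ZMod 2 with (∀ j, j < i → v j = u j) ∧ v i = b,
    ((2 : ℝ≥0∞) ^ (2 ^ n - 1))⁻¹ * blockProb W (polarEncode v) y

open Classical in
/-- Successive cancellation decoding for the channel `W`, the set `info` of information indices
and the values `frozen` of the other bits: in increasing order of `i`, the bit `i` is the frozen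
one if `i ∉ info`, and otherwise it is decided by comparing the two likelihoods under the
polarized channel, given the decisions already made (a tie gives `0`). -/
def scDecode {n : ℕ} {Y : Type*} (W : Channel Y) (info : Finset (Fin (2 ^ n)))
    (frozen : Fin (2 ^ n) → ZMod 2) (y : Fin (2 ^ n) → Y) (i : Fin (2 ^ n)) : ZMod 2 :=
  let past : Fin (2 ^ n) → ZMod 2 := fun j =>
    if _h : j < i then scDecode W info frozen y j else 0
  if i ∈ info then
    if polarizedChannel W i y past 1 ≤ polarizedChannel W i y past 0 then 0 else 1
  else frozen i
termination_by i

/-! ### The receiver-orthogonal relay channel -/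

/-- A receiver-orthogonal relay channel with binary inputs `X` (sender) and `X₁` (relay): the
sender's input produces the pair `(Y', Y₁)`, observed by the destination and by the relay
respectively, and the relay's input independently produces `Y''`, observed by the destination.
The law of `((y', y₁), y'')` given `(x, x₁)` is `source x (y', y₁) * rd x₁ y''`. -/
structure RelayChannel (Y' Y₁ Y'' : Type*) where
  /-- `P_{Y' Y₁ | X}` -/
  source : Channel (Y' × Y₁)
  /-- `P_{Y'' | X₁}`, the relay to destination channel -/
  rd : Channel Y''

namespace RelayChannel

variable {Y' Y₁ Y'' : Type*}

/-- The source to destination channel `P_{Y' | X}`. -/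
def sd (ch : RelayChannel Y' Y₁ Y'') : Channel Y' := fun x => (ch.source x).map Prod.fst

/-- The source to relay channel `P_{Y₁ | X}`. -/
def sr (ch : RelayChannel Y' Y₁ Y'') : Channel Y₁ := fun x => (ch.source x).map Prod.snd

/-- Physical degradedness, `P_{Y' Y₁ | X} = P_{Y₁ | X} P_{Y' | Y₁}`. -/
def IsPhysicallyDegraded (ch : RelayChannel Y' Y₁ Y'') : Prop :=
  ∃ Q : Y₁ → PMF Y', ∀ x y' y₁, ch.source x (y', y₁) = ch.sr x y₁ * Q y₁ y'

/-- `sup_{p(x) p(x₁)} min {I(X;Y') + I(X₁;Y''), I(X;Y',Y₁)}`. -/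
def capacity (ch : RelayChannel Y' Y₁ Y'') : ℝ :=
  ⨆ q : PMF (ZMod 2) × PMF (ZMod 2),
    min (mutualInfo q.1 ch.sd + mutualInfo q.2 ch.rd) (mutualInfo q.1 ch.source)

end RelayChannel

/-! ### The block-Markov scheme with nested polar codes -/

/-- The codes used in every block: the source uses the nested polar code `P(N, A, B)`, with
`N = 2 ^ n`, and the relay uses the polar code `P(N, D)`, whose information bits carry the bits of
`A \ B` that select the coset of `P(N, B)`. -/
structure NestedCode (n : ℕ) where
  A : Finset (Fin (2 ^ n))
  B : Finset (Fin (2 ^ n))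
  D : Finset (Fin (2 ^ n))
  subset : B ⊆ A
  relabel : {i // i ∈ A \ B} ≃ {i // i ∈ D}

namespace NestedCode

variable {n : ℕ} {Y' Y₁ Y'' : Type*}

/-- The messages sent over `b + 1` blocks: `|A|` bits for each of the first `b` blocks. -/
abbrev Message (c : NestedCode n) (b : ℕ) := Fin b → {i // i ∈ c.A} → ZMod 2

/-- The number of message bits per channel use. -/
def rate (c : NestedCode n) (b : ℕ) : ℝ :=
  (b * c.A.card : ℝ) / ((b + 1) * 2 ^ n)

/-- The bits that the source encodes in each of the `b + 1` blocks: the message bits on `A` and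
zeros elsewhere in the first `b` blocks, and only zeros in the last block. -/
def sourceBits (c : NestedCode n) {b : ℕ} (m : c.Message b) :
    Fin (b + 1) → Fin (2 ^ n) → ZMod 2 :=
  Fin.snoc (α := fun _ => Fin (2 ^ n) → ZMod 2)
    (fun k i => if h : i ∈ c.A then m k ⟨i, h⟩ else 0) 0

/-- The bits that the relay encodes in the block after it has received `y₁`: it decodes the bits
in `A` and places those of `A \ B` on the information indices `D`. -/
def relayForward (c : NestedCode n) (ch : RelayChannel Y' Y₁ Y'') (y₁ : Fin (2 ^ n) → Y₁) :
    Fin (2 ^ n) → ZMod 2 := fun d =>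
  if h : d ∈ c.D then scDecode ch.sr c.A 0 y₁ (c.relabel.symm ⟨d, h⟩).val else 0

/-- The bits that the relay encodes in each of the `b + 1` blocks: only zeros in the first block,
and in each later block a function of what the relay received in the preceding block. -/
def relayBits (c : NestedCode n) (ch : RelayChannel Y' Y₁ Y'') {b : ℕ}
    (y₁ : Fin (b + 1) → Fin (2 ^ n) → Y₁) : Fin (b + 1) → Fin (2 ^ n) → ZMod 2 :=
  Fin.cons (α := fun _ => Fin (2 ^ n) → ZMod 2) 0
    (fun k : Fin b => c.relayForward ch (y₁ k.castSucc))

/-- The destination's estimate of the bits that the source sent in one block, from the output `y'`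
of the source's channel in that block and the output `y''` of the relay's channel in the next
block: `y''` is decoded first and gives the bits of `A \ B`, and `y'` is then decoded in the coset
of `P(N, B)` which they determine. -/
def destBlock (c : NestedCode n) (ch : RelayChannel Y' Y₁ Y'')
    (y' : Fin (2 ^ n) → Y') (y'' : Fin (2 ^ n) → Y'') : Fin (2 ^ n) → ZMod 2 :=
  scDecode ch.sd c.B
    (fun i => if h : i ∈ c.A \ c.B then scDecode ch.rd c.D 0 y'' (c.relabel ⟨i, h⟩).val else 0) y'

/-- The destination's estimate of the whole message. -/
def destDecode (c : NestedCode n) (ch : RelayChannel Y' Y₁ Y'') {b : ℕ}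
    (y' : Fin (b + 1) → Fin (2 ^ n) → Y') (y'' : Fin (b + 1) → Fin (2 ^ n) → Y'') :
    c.Message b :=
  fun k i => c.destBlock ch (y' k.castSucc) (y'' k.succ) i.val

/-- The probability of the outputs `y'`, `y₁`, `y''` over the `b + 1` blocks when the message is
`m`: the channel is memoryless and the relay's inputs depend on its outputs in earlier blocks. -/
def outputProb (c : NestedCode n) (ch : RelayChannel Y' Y₁ Y'') {b : ℕ} (m : c.Message b)
    (y' : Fin (b + 1) → Fin (2 ^ n) → Y') (y₁ : Fin (b + 1) → Fin (2 ^ n) → Y₁)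
    (y'' : Fin (b + 1) → Fin (2 ^ n) → Y'') : ℝ≥0∞ :=
  ∏ k, (blockProb ch.source (polarEncode (c.sourceBits m k)) (fun j => (y' k j, y₁ k j)) *
    blockProb ch.rd (polarEncode (c.relayBits ch y₁ k)) (y'' k))

open Classical in
/-- The probability that the destination's estimate differs from the message `m` sent. -/
def errorProb (c : NestedCode n) (ch : RelayChannel Y' Y₁ Y'') {b : ℕ} (m : c.Message b) :
    ℝ≥0∞ :=
  ∑' (y' : Fin (b + 1) → Fin (2 ^ n) → Y') (y₁ : Fin (b + 1) → Fin (2 ^ n) → Y₁)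
    (y'' : Fin (b + 1) → Fin (2 ^ n) → Y''),
    if c.destDecode ch y' y'' ≠ m then c.outputProb ch m y' y₁ y'' else 0

end NestedCode

end PolarRelay

end

/-! Polarization of symmetric channels and the achievability of the capacity of degraded relay
channels with nested polar codes. -/

noncomputable section

namespace PolarRelay

-- The proof combines polarization of a single symmetric channel with nesting of the resulting
-- codes.
--
-- Polarization. One step replaces `W` by `W.minus` and `W.plus`. It conserves the average mutual
-- information I under uniform input (`symInfo_minus_add_plus`), while the Bhattacharyya parameter Z
-- satisfies Z(W⁺) = Z² and Z(W⁻) ≤ 2Z - Z². Hence the average of √Z over the polarization tree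
-- decreases at each step by at least the average of √Z(1 - Z)²/8 (`sqrt_bhatt_step`), so at some
-- depth m this drop is small and most channels have Z near 0 or near 1. Since I ≤ 4(1 - Z),
-- conservation forces a fraction of nearly I(W) to have Z near 0. From there the average of Z^(1/4)
-- shrinks by 7/10 < 1/√2 per step, fast enough to bring Z below 4^(-n)
-- (`exists_forall_le_goodFrac`). A union bound over at most 2^n good indices then gives an SC
-- failure probability of at most 2^(-n), and symmetry makes it valid for every word sent
-- (`tsum_scFailure_le`).
--
-- Nesting. Degradation survives polarization and makes Z larger, so the good indices of SD are good
-- for SR (`goodSet_subset_of_isDegradedOf`). Take `B` to be the good set of SD and `A` a set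
-- between it and the good set of SR; the bits of `A \ B` fit into good indices of RD as soon as |A|
-- is at most the sum of the sizes of the good sets of SD and RD. This gives |A|/N close to min(I_SD
-- + I_RD, I_SR), and the loss b/(b + 1) vanishes for many blocks. Three SC decodings per block are
-- all that can fail (`NestedCode.errorProb_le`).
--
-- Capacity. The uniform input maximizes all the mutual informations at once, so the supremum of the
-- minimum is the minimum of the maxima; degradedness reduces I(X;Y',Y₁) to I(X;Y₁)
-- (`relayCapacity_eq`).

universe u

/-! ### Splitting block indices into halves and into pairs -/

section Index

variable {n : ℕ}

/-- The index `i` in the first half of a block of doubled length. -/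
def lo (i : Fin (2 ^ n)) : Fin (2 ^ (n + 1)) := ⟨i, by have := i.2; rw [pow_succ]; omega⟩

/-- The index `i` in the second half of a block of doubled length. -/
def hi (i : Fin (2 ^ n)) : Fin (2 ^ (n + 1)) := ⟨2 ^ n + i, by have := i.2; rw [pow_succ]; omega⟩

/-- The `j`-th even index. -/
def ev (j : Fin (2 ^ n)) : Fin (2 ^ (n + 1)) := ⟨2 * j, by have := j.2; rw [pow_succ]; omega⟩

/-- The `j`-th odd index. -/
def od (j : Fin (2 ^ n)) : Fin (2 ^ (n + 1)) :=
  ⟨2 * j + 1, by have := j.2; rw [pow_succ]; omega⟩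

lemma bijective_lo_hi :
    Function.Bijective (Sum.elim lo hi : Fin (2 ^ n) ⊕ Fin (2 ^ n) → Fin (2 ^ (n + 1))) := by
  rw [Fintype.bijective_iff_injective_and_card]
  refine ⟨?_, by simp [pow_succ, mul_two]⟩
  rintro (a | a) (b | b) h <;> have := a.2 <;> have := b.2 <;>
    simp [lo, hi, Fin.ext_iff] at h ⊢ <;> omega

lemma bijective_ev_od :
    Function.Bijective (Sum.elim ev od : Fin (2 ^ n) ⊕ Fin (2 ^ n) → Fin (2 ^ (n + 1))) := by
  rw [Fintype.bijective_iff_injective_and_card]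
  refine ⟨?_, by simp [pow_succ, mul_two]⟩
  rintro (a | a) (b | b) h <;> simp [ev, od, Fin.ext_iff] at h ⊢ <;> omega

/-- Indices as the disjoint union of the two halves. -/
def halfEquiv (n : ℕ) : Fin (2 ^ n) ⊕ Fin (2 ^ n) ≃ Fin (2 ^ (n + 1)) :=
  Equiv.ofBijective _ bijective_lo_hi

/-- Indices as the disjoint union of the even and of the odd ones. -/
def parityEquiv (n : ℕ) : Fin (2 ^ n) ⊕ Fin (2 ^ n) ≃ Fin (2 ^ (n + 1)) :=
  Equiv.ofBijective _ bijective_ev_od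

lemma forall_half {p : Fin (2 ^ (n + 1)) → Prop} :
    (∀ i, p i) ↔ (∀ i, p (lo i)) ∧ ∀ i, p (hi i) := by
  rw [← (halfEquiv n).forall_congr_right, Sum.forall]; rfl

lemma sum_half {M : Type*} [AddCommMonoid M] (f : Fin (2 ^ (n + 1)) → M) :
    ∑ i, f i = ∑ i, f (lo i) + ∑ i, f (hi i) := by
  rw [← (halfEquiv n).sum_comp, Fintype.sum_sum_type]; rfl

lemma prod_parity {M : Type*} [CommMonoid M] (f : Fin (2 ^ (n + 1)) → M) :
    ∏ i, f i = ∏ j, (f (ev j) * f (od j)) := by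
  rw [← (parityEquiv n).prod_comp, Fintype.prod_sum_type, Finset.prod_mul_distrib]; rfl

/-- A word as the pair of its halves. -/
def splitHalf (n : ℕ) (α : Type*) :
    (Fin (2 ^ (n + 1)) → α) ≃ (Fin (2 ^ n) → α) × (Fin (2 ^ n) → α) :=
  ((halfEquiv n).symm.arrowCongr (Equiv.refl α)).trans (Equiv.sumArrowEquivProdArrow _ _ _)

/-- A word as the sequence of its consecutive pairs. -/
def splitPairs (n : ℕ) (α : Type*) :
    (Fin (2 ^ (n + 1)) → α) ≃ (Fin (2 ^ n) → α × α) :=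
  (((parityEquiv n).symm.arrowCongr (Equiv.refl α)).trans
    (Equiv.sumArrowEquivProdArrow _ _ _)).trans (Equiv.arrowProdEquivProdArrow _ _ _).symm

lemma splitHalf_apply {α : Type*} (u : Fin (2 ^ (n + 1)) → α) :
    splitHalf n α u = (u ∘ lo, u ∘ hi) := rfl

lemma lo_lt_lo {i j : Fin (2 ^ n)} : lo i < lo j ↔ i < j := by
  rw [Fin.lt_def, Fin.lt_def]; rfl
lemma hi_lt_hi {i j : Fin (2 ^ n)} : hi i < hi j ↔ i < j := by
  rw [Fin.lt_def, Fin.lt_def]; simp [hi]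
lemma lo_lt_hi (i j : Fin (2 ^ n)) : lo i < hi j := by
  have := i.2; simp only [lo, hi, Fin.lt_def]; omega
lemma not_hi_lt_lo (i j : Fin (2 ^ n)) : ¬ hi i < lo j := (lo_lt_hi j i).asymm

end Index

/-! ### The recursive structure of the polar transform -/

section Encode

variable {n : ℕ}

lemma bitRev_testBit (i : Fin (2 ^ n)) (k : Fin n) :
    (bitRev i).val.testBit k = i.val.testBit k.rev := by
  simp [bitRev]

/-- Bit reversal pairs the top digit of the row with the lowest digit of the column. This is why `u`
splits into halves in the recursion while codewords and outputs split into consecutive pairs. -/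
lemma polarMatrix_apply (i j : Fin (2 ^ n)) :
    polarMatrix n i j = ∏ k : Fin n, kernelF (i.val.testBit k.rev) (j.val.testBit k) := by
  simp only [polarMatrix, kronPow, Matrix.submatrix_apply, Matrix.of_apply, id, bitRev_testBit]

lemma polarMatrix_lo_ev (i j : Fin (2 ^ n)) :
    polarMatrix (n + 1) (lo i) (ev j) = polarMatrix n i j := by
  simp only [polarMatrix_apply, Fin.prod_univ_succ, lo, ev]
  have h : i.val.testBit n = false := Nat.testBit_lt_two_pow i.2
  simp [kernelF, h, Nat.testBit_succ]

lemma polarMatrix_lo_od (i j : Fin (2 ^ n)) :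
    polarMatrix (n + 1) (lo i) (od j) = 0 := by
  simp only [polarMatrix_apply, Fin.prod_univ_succ, lo, od]
  have h : i.val.testBit n = false := Nat.testBit_lt_two_pow i.2
  simp [kernelF, h]

lemma polarMatrix_hi_ev (i j : Fin (2 ^ n)) :
    polarMatrix (n + 1) (hi i) (ev j) = polarMatrix n i j := by
  simp only [polarMatrix_apply, Fin.prod_univ_succ, hi, ev]
  have h (k : Fin n) : (2 ^ n + i.val).testBit k.rev = i.val.testBit k.rev :=
    Nat.testBit_two_pow_add_gt k.rev.2 _
  simp only [Fin.rev_succ, Fin.val_castSucc, h]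
  simp [kernelF, Nat.testBit_succ]

lemma polarMatrix_hi_od (i j : Fin (2 ^ n)) :
    polarMatrix (n + 1) (hi i) (od j) = polarMatrix n i j := by
  simp only [polarMatrix_apply, Fin.prod_univ_succ, hi, od]
  have h (k : Fin n) : (2 ^ n + i.val).testBit k.rev = i.val.testBit k.rev :=
    Nat.testBit_two_pow_add_gt k.rev.2 _
  simp only [Fin.rev_succ, Fin.val_castSucc, h]
  have h' : (2 ^ n + i.val).testBit n = true := by
    rw [Nat.testBit_two_pow_add_eq, Nat.testBit_lt_two_pow i.2]; rfl
  have hj : (2 * j.val + 1) / 2 = j.val := by omega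
  simp [kernelF, Nat.testBit_succ, h', hj]

lemma polarEncode_ev (u : Fin (2 ^ (n + 1)) → ZMod 2) (j : Fin (2 ^ n)) :
    polarEncode u (ev j) = polarEncode (u ∘ lo) j + polarEncode (u ∘ hi) j := by
  simp only [polarEncode, Matrix.vecMul, dotProduct, sum_half, polarMatrix_lo_ev,
    polarMatrix_hi_ev, Function.comp]

lemma polarEncode_od (u : Fin (2 ^ (n + 1)) → ZMod 2) (j : Fin (2 ^ n)) :
    polarEncode u (od j) = polarEncode (u ∘ hi) j := by
  simp only [polarEncode, Matrix.vecMul, dotProduct, sum_half, polarMatrix_lo_od,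
    polarMatrix_hi_od, Function.comp, mul_zero, Finset.sum_const_zero, zero_add]

lemma polarEncode_add (u v : Fin (2 ^ n) → ZMod 2) :
    polarEncode (u + v) = polarEncode u + polarEncode v := Matrix.add_vecMul _ _ _

lemma polarEncode_zero_length (u : Fin (2 ^ 0) → ZMod 2) : polarEncode u = u := by
  funext j
  have hj : j = 0 := Subsingleton.elim (α := Fin 1) j 0
  simp [polarEncode, Matrix.vecMul, dotProduct, polarMatrix_apply, hj]

lemma polarEncode_injective : ∀ n, Function.Injective (polarEncode (n := n))
  | 0 => fun u v h => by simpa [polarEncode_zero_length] using h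
  | n + 1 => fun u v h => by
    have hhi : u ∘ hi = v ∘ hi := polarEncode_injective n <| by
      funext j; rw [← polarEncode_od, ← polarEncode_od, h]
    have hlo : u ∘ lo = v ∘ lo := polarEncode_injective n <| by
      funext j
      have := congrFun h (ev j)
      rw [polarEncode_ev, polarEncode_ev, hhi] at this
      exact add_right_cancel this
    exact (splitHalf n _).injective (by rw [splitHalf_apply, splitHalf_apply, hlo, hhi])

/-- The polar transform as a permutation of the words. -/
def encodeEquiv (n : ℕ) : (Fin (2 ^ n) → ZMod 2) ≃ (Fin (2 ^ n) → ZMod 2) :=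
  Equiv.ofBijective polarEncode (Finite.injective_iff_bijective.mp (polarEncode_injective n))

lemma encodeEquiv_apply (u : Fin (2 ^ n) → ZMod 2) : encodeEquiv n u = polarEncode u := rfl

end Encode

/-! ### The two synthetic channels of one polarization step -/

lemma zmod_two_sum {M : Type*} [AddCommMonoid M] (f : ZMod 2 → M) : ∑ x, f x = f 0 + f 1 :=
  Fin.sum_univ_two f

lemma PMF_bind_map_mk {α β : Type*} (p : PMF α) (q : PMF β) (a : α) (b : β) :
    (p.bind fun a => q.map (Prod.mk a)) (a, b) = p a * q b := by
  rw [PMF.bind_apply, tsum_eq_single a, PMF.map_apply, tsum_eq_single b]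
  · simp
  · intro b' hb; simp [hb.symm]
  · intro a' ha; simp [PMF.map_apply, ha.symm]

/-- The channel `u ↦ (y₁, y₂)`, where `y₁`, `y₂` are the outputs of two uses of `W` with inputs
`u + v` and `v`, for a uniform bit `v`. -/
def Channel.minus {Y : Type*} (W : Channel Y) : Channel (Y × Y) := fun u =>
  (PMF.uniformOfFintype (ZMod 2)).bind fun v => (W (u + v)).bind fun y => (W v).map (Prod.mk y)

/-- The channel `v ↦ (y₁, y₂, u)`, where `y₁`, `y₂` are the outputs of two uses of `W` with inputs
`u + v` and `v`, for a uniform bit `u`. -/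
def Channel.plus {Y : Type*} (W : Channel Y) : Channel ((Y × Y) × ZMod 2) := fun v =>
  (PMF.uniformOfFintype (ZMod 2)).bind fun u =>
    ((W (u + v)).bind fun y => (W v).map (Prod.mk y)).map fun p => (p, u)

lemma Channel.minus_apply {Y : Type*} (W : Channel Y) (u : ZMod 2) (y : Y × Y) :
    W.minus u y = 2⁻¹ * ∑ v, W (u + v) y.1 * W v y.2 := by
  obtain ⟨y₁, y₂⟩ := y
  simp only [Channel.minus]
  rw [PMF.bind_apply, tsum_fintype, Finset.mul_sum]
  refine Finset.sum_congr rfl fun v _ => ?_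
  rw [PMF_bind_map_mk, PMF.uniformOfFintype_apply, ZMod.card]; rfl

lemma Channel.plus_apply {Y : Type*} (W : Channel Y) (v : ZMod 2) (y : (Y × Y) × ZMod 2) :
    W.plus v y = 2⁻¹ * (W (y.2 + v) y.1.1 * W v y.1.2) := by
  obtain ⟨⟨y₁, y₂⟩, u⟩ := y
  simp only [Channel.plus]
  rw [PMF.bind_apply, tsum_eq_single u, PMF.map_apply, tsum_eq_single (y₁, y₂), PMF_bind_map_mk]
  · simp
  · rintro p hp; rw [if_neg]; simpa using fun h => hp h.symm
  · intro u' hu; rw [PMF.map_apply]; simp [hu.symm]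

/-- The probabilities of a channel as real numbers. -/
def Channel.real {Y : Type*} (W : Channel Y) (x : ZMod 2) (y : Y) : ℝ := (W x y).toReal

section Real

variable {Y : Type*} (W : Channel Y)

lemma Channel.real_nonneg (x : ZMod 2) (y : Y) : 0 ≤ W.real x y := ENNReal.toReal_nonneg

lemma Channel.ofReal_real (x : ZMod 2) (y : Y) : ENNReal.ofReal (W.real x y) = W x y :=
  ENNReal.ofReal_toReal ((W x).apply_ne_top y)

lemma Channel.hasSum_real (x : ZMod 2) : HasSum (W.real x) 1 := by
  have h : ∑' y, W x y ≠ ∞ := (W x).tsum_coe_ne_top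
  have := (ENNReal.summable_toReal h).hasSum
  rwa [← ENNReal.tsum_toReal_eq fun y => (W x).apply_ne_top y, (W x).tsum_coe,
    ENNReal.toReal_one] at this

lemma Channel.minus_real (u : ZMod 2) (y : Y × Y) :
    W.minus.real u y = (W.real u y.1 * W.real 0 y.2 + W.real (u + 1) y.1 * W.real 1 y.2) / 2 := by
  have h (x : ZMod 2) (y : Y) : W x y ≠ ∞ := (W x).apply_ne_top y
  simp only [Channel.real, Channel.minus_apply, zmod_two_sum, add_zero, ENNReal.toReal_mul]
  rw [ENNReal.toReal_add (ENNReal.mul_ne_top (h _ _) (h _ _)) (ENNReal.mul_ne_top (h _ _) (h _ _))]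
  simp only [ENNReal.toReal_mul, ENNReal.toReal_inv, ENNReal.toReal_ofNat]
  ring

lemma Channel.plus_real (v : ZMod 2) (y : (Y × Y) × ZMod 2) :
    W.plus.real v y = W.real (y.2 + v) y.1.1 * W.real v y.1.2 / 2 := by
  simp only [Channel.real, Channel.plus_apply, ENNReal.toReal_mul, ENNReal.toReal_inv,
    ENNReal.toReal_ofNat]
  ring

/-- The probability of an output under the uniform input. -/
def Channel.outReal (y : Y) : ℝ := (W.real 0 y + W.real 1 y) / 2

lemma Channel.hasSum_outReal : HasSum W.outReal 1 := by
  have := ((W.hasSum_real 0).add (W.hasSum_real 1)).div_const 2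
  norm_num at this
  exact this

lemma Channel.outReal_nonneg (y : Y) : 0 ≤ W.outReal y := by
  have := W.real_nonneg 0 y; have := W.real_nonneg 1 y
  unfold Channel.outReal; positivity

/-! ### The Bhattacharyya parameter -/

/-- The contribution of one output to the Bhattacharyya parameter. -/
def Channel.bhattTerm (y : Y) : ℝ := √(W.real 0 y) * √(W.real 1 y)

/-- The Bhattacharyya parameter. -/
def Channel.bhatt : ℝ := ∑' y, W.bhattTerm y

lemma Channel.bhattTerm_nonneg (y : Y) : 0 ≤ W.bhattTerm y := by
  unfold Channel.bhattTerm; positivity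

lemma Channel.bhattTerm_le (y : Y) : W.bhattTerm y ≤ W.outReal y := by
  have h0 := Real.sq_sqrt (W.real_nonneg 0 y)
  have h1 := Real.sq_sqrt (W.real_nonneg 1 y)
  unfold Channel.bhattTerm Channel.outReal
  nlinarith [sq_nonneg (√(W.real 0 y) - √(W.real 1 y))]

lemma Channel.summable_bhattTerm : Summable W.bhattTerm :=
  W.hasSum_outReal.summable.of_nonneg_of_le W.bhattTerm_nonneg W.bhattTerm_le

lemma Channel.hasSum_bhatt : HasSum W.bhattTerm W.bhatt := W.summable_bhattTerm.hasSum

lemma Channel.bhatt_nonneg : 0 ≤ W.bhatt := tsum_nonneg W.bhattTerm_nonneg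

lemma Channel.bhatt_le_one : W.bhatt ≤ 1 := hasSum_le W.bhattTerm_le W.hasSum_bhatt W.hasSum_outReal

lemma hasSum_mul_prod {α β : Type*} {f : α → ℝ} {g : β → ℝ} {a b : ℝ} (hf : HasSum f a)
    (hg : HasSum g b) (hf0 : ∀ x, 0 ≤ f x) (hg0 : ∀ y, 0 ≤ g y) :
    HasSum (fun p : α × β => f p.1 * g p.2) (a * b) :=
  hf.mul hg (hf.summable.mul_of_nonneg hg.summable hf0 hg0)

lemma hasSum_prod_zmod_two {α : Type*} {f : α × ZMod 2 → ℝ} {a : ℝ} (hf0 : ∀ x, 0 ≤ f x)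
    (hf : HasSum (fun x => f (x, 0) + f (x, 1)) a) : HasSum f a := by
  have hs : Summable f := by
    rw [summable_prod_of_nonneg hf0]
    refine ⟨fun x => Summable.of_finite, ?_⟩
    simpa only [tsum_fintype, zmod_two_sum] using hf.summable
  have := hs.hasSum.prod_fiberwise (fun x => (hasSum_fintype fun c => f (x, c)))
  simp only [zmod_two_sum] at this
  rw [hf.unique this]
  exact hs.hasSum

/-- For either value of `u`, the term at (y₁, y₂, u) is half the product of the terms of `W` at y₁
and y₂. -/
lemma Channel.bhatt_plus : W.plus.bhatt = W.bhatt ^ 2 := by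
  refine HasSum.tsum_eq (hasSum_prod_zmod_two W.plus.bhattTerm_nonneg ?_)
  rw [sq]
  convert hasSum_mul_prod W.hasSum_bhatt W.hasSum_bhatt W.bhattTerm_nonneg W.bhattTerm_nonneg
    using 2 with y
  have h11 : (1 + 1 : ZMod 2) = 0 := rfl
  simp only [Channel.bhattTerm, Channel.plus_real, add_zero, zero_add, h11]
  have h2 : √(2 : ℝ) * √2 = 2 := Real.mul_self_sqrt (by norm_num)
  have h (x : ZMod 2) (y : Y) := W.real_nonneg x y
  rw [Real.sqrt_div (mul_nonneg (h _ _) (h _ _)), Real.sqrt_div (mul_nonneg (h _ _) (h _ _)),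
    Real.sqrt_div (mul_nonneg (h _ _) (h _ _)), Real.sqrt_div (mul_nonneg (h _ _) (h _ _)),
    Real.sqrt_mul (h _ _), Real.sqrt_mul (h _ _), Real.sqrt_mul (h _ _), Real.sqrt_mul (h _ _),
    div_mul_div_comm, div_mul_div_comm, h2]
  ring

lemma sqrt_minus_le {a b c d : ℝ} (ha : 0 ≤ a) (hb : 0 ≤ b) (hc : 0 ≤ c) (hd : 0 ≤ d) :
    √((a ^ 2 * c ^ 2 + b ^ 2 * d ^ 2) / 2) * √((b ^ 2 * c ^ 2 + a ^ 2 * d ^ 2) / 2) ≤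
      a * b * ((c ^ 2 + d ^ 2) / 2) + (a ^ 2 + b ^ 2) / 2 * (c * d) - a * b * (c * d) := by
  rw [← Real.sqrt_mul (by positivity)]
  have hab : 0 ≤ a * b := mul_nonneg ha hb
  have hcd : 0 ≤ c * d := mul_nonneg hc hd
  have h1 : 0 ≤ (c - d) ^ 2 := sq_nonneg _
  have h2 : 0 ≤ (a - b) ^ 2 := sq_nonneg _
  refine Real.sqrt_le_iff.mpr ⟨?_, ?_⟩
  · nlinarith [mul_nonneg hab h1, mul_nonneg hcd h2, mul_nonneg hab hcd]
  -- The difference of the two squares is exactly ab·cd·(a - b)²(c - d)²/2.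
  · have := mul_nonneg (mul_nonneg hab hcd) (mul_nonneg h1 h2)
    nlinarith

lemma Channel.bhatt_minus_le : W.minus.bhatt ≤ 2 * W.bhatt - W.bhatt ^ 2 := by
  have h1 := hasSum_mul_prod W.hasSum_bhatt W.hasSum_outReal W.bhattTerm_nonneg W.outReal_nonneg
  have h2 := hasSum_mul_prod W.hasSum_outReal W.hasSum_bhatt W.outReal_nonneg W.bhattTerm_nonneg
  have h3 := hasSum_mul_prod W.hasSum_bhatt W.hasSum_bhatt W.bhattTerm_nonneg W.bhattTerm_nonneg
  have h := hasSum_le (fun y => ?_) W.minus.hasSum_bhatt ((h1.add h2).sub h3)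
  · linarith
  · have h11 : (1 + 1 : ZMod 2) = 0 := rfl
    have := sqrt_minus_le (Real.sqrt_nonneg (W.real 0 y.1)) (Real.sqrt_nonneg (W.real 1 y.1))
      (Real.sqrt_nonneg (W.real 0 y.2)) (Real.sqrt_nonneg (W.real 1 y.2))
    simp only [Real.sq_sqrt (W.real_nonneg _ _)] at this
    simpa only [Channel.bhattTerm, Channel.minus_real, Channel.outReal, zero_add, h11] using this

/-! ### The symmetric information -/

/-- The contribution of an output to the mutual information under the uniform input, where the
output has probabilities `a` and `b` given the two inputs. -/
def infoTerm (a b : ℝ) : ℝ :=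
  (a * Real.logb 2 (2 * a / (a + b)) + b * Real.logb 2 (2 * b / (a + b))) / 2

lemma mul_logb_le {a b : ℝ} (ha : 0 ≤ a) (hb : 0 ≤ b) : a * Real.logb 2 (2 * a / (a + b)) ≤ a := by
  rcases ha.eq_or_lt with rfl | ha
  · simp
  refine mul_le_of_le_one_right ha.le ?_
  rw [Real.logb_le_iff_le_rpow (by norm_num) (by positivity), Real.rpow_one, div_le_iff₀ (by positivity)]
  linarith

lemma infoTerm_le {a b : ℝ} (ha : 0 ≤ a) (hb : 0 ≤ b) : infoTerm a b ≤ (a + b) / 2 := by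
  have h1 := mul_logb_le ha hb
  have h2 := mul_logb_le hb ha
  rw [add_comm b a] at h2
  unfold infoTerm; linarith

lemma sub_le_mul_log {a b : ℝ} (ha : 0 ≤ a) (hb : 0 ≤ b) :
    a - (a + b) / 2 ≤ a * Real.log (2 * a / (a + b)) := by
  rcases ha.eq_or_lt with rfl | ha
  · simp; linarith
  have h := Real.one_sub_inv_le_log_of_pos (x := 2 * a / (a + b)) (by positivity)
  have := mul_le_mul_of_nonneg_left h ha.le
  refine le_trans (le_of_eq ?_) this
  field_simp

lemma mul_log_le_sub {a b : ℝ} (ha : 0 ≤ a) (hb : 0 ≤ b) :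
    a * Real.log (2 * a / (a + b)) ≤ a * (2 * a / (a + b) - 1) := by
  rcases ha.eq_or_lt with rfl | ha
  · simp
  exact mul_le_mul_of_nonneg_left (Real.log_le_sub_one_of_pos (by positivity)) ha.le

lemma infoTerm_eq_log (a b : ℝ) : infoTerm a b =
    (a * Real.log (2 * a / (a + b)) + b * Real.log (2 * b / (b + a))) / (2 * Real.log 2) := by
  have : Real.log 2 ≠ 0 := (Real.log_pos one_lt_two).ne'
  rw [infoTerm, Real.logb, Real.logb, add_comm b a]; field_simp

lemma infoTerm_nonneg {a b : ℝ} (ha : 0 ≤ a) (hb : 0 ≤ b) : 0 ≤ infoTerm a b := by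
  have h1 := sub_le_mul_log ha hb
  have h2 := sub_le_mul_log hb ha
  have : 0 < Real.log 2 := Real.log_pos one_lt_two
  rw [infoTerm_eq_log]
  refine div_nonneg (by linarith) (by positivity)

/-- From log x ≤ x - 1 comes the bound (a - b)²/(a + b), which is at most 2(√a - √b)². The constant
4 is not sharp: it only matters that Z near 1 forces I near 0. -/
lemma infoTerm_le_sqrt {a b : ℝ} (ha : 0 ≤ a) (hb : 0 ≤ b) :
    infoTerm a b ≤ 4 * ((a + b) / 2 - √a * √b) := by
  have h1 := mul_log_le_sub ha hb
  have h2 := mul_log_le_sub hb ha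
  have hl : 1 / 2 < Real.log 2 := by linarith [Real.log_two_gt_d9]
  rcases (add_nonneg ha hb).eq_or_lt with h0 | h0
  · obtain rfl : a = 0 := by linarith
    obtain rfl : b = 0 := by linarith
    simp [infoTerm]
  rw [infoTerm_eq_log, div_le_iff₀ (by linarith)]
  have hs1 := Real.sq_sqrt ha
  have hs2 := Real.sq_sqrt hb
  have hnn : 0 ≤ (√a - √b) ^ 2 := sq_nonneg _
  have key : a * (2 * a / (a + b) - 1) + b * (2 * b / (b + a) - 1) ≤ 2 * (√a - √b) ^ 2 := by
    have : a * (2 * a / (a + b) - 1) + b * (2 * b / (b + a) - 1) = (a - b) ^ 2 / (a + b) := by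
      rw [add_comm b a]; field_simp; ring
    rw [this, div_le_iff₀ h0]
    have e : (a - b) ^ 2 = (√a - √b) ^ 2 * (√a + √b) ^ 2 := by
      rw [← mul_pow, ← hs1, ← hs2]; simp only [Real.sqrt_sq (Real.sqrt_nonneg _)]; ring
    rw [e]
    have : (√a + √b) ^ 2 ≤ 2 * (a + b) := by nlinarith
    nlinarith [mul_le_mul_of_nonneg_left this hnn]
  have : 4 * ((a + b) / 2 - √a * √b) * (2 * Real.log 2) = 4 * (√a - √b) ^ 2 * Real.log 2 := by
    rw [sub_sq, hs1, hs2]; ring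
  rw [this]
  nlinarith

/-- The mutual information under the uniform input. -/
def Channel.symInfo : ℝ := ∑' y, infoTerm (W.real 0 y) (W.real 1 y)

lemma Channel.infoTerm_nonneg (y : Y) : 0 ≤ infoTerm (W.real 0 y) (W.real 1 y) :=
  PolarRelay.infoTerm_nonneg (W.real_nonneg _ _) (W.real_nonneg _ _)

lemma Channel.hasSum_symInfo :
    HasSum (fun y => infoTerm (W.real 0 y) (W.real 1 y)) W.symInfo :=
  (W.hasSum_outReal.summable.of_nonneg_of_le W.infoTerm_nonneg
    fun _ => infoTerm_le (W.real_nonneg _ _) (W.real_nonneg _ _)).hasSum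

lemma Channel.symInfo_le_one : W.symInfo ≤ 1 :=
  hasSum_le (fun _ => infoTerm_le (W.real_nonneg _ _) (W.real_nonneg _ _)) W.hasSum_symInfo
    W.hasSum_outReal

lemma Channel.symInfo_le_bhatt : W.symInfo ≤ 4 * (1 - W.bhatt) :=
  hasSum_le (fun _ => infoTerm_le_sqrt (W.real_nonneg _ _) (W.real_nonneg _ _)) W.hasSum_symInfo
    ((W.hasSum_outReal.sub W.hasSum_bhatt).mul_left 4)

lemma mul_log_two_mul_div {a b : ℝ} (ha : 0 ≤ a) (hb : 0 ≤ b) :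
    a * Real.log (2 * a / (a + b)) = a * Real.log 2 - Real.negMulLog a - a * Real.log (a + b) := by
  rcases ha.eq_or_lt with rfl | ha
  · simp
  rw [Real.log_div (by positivity) (by positivity), Real.log_mul (by norm_num) ha.ne',
    Real.negMulLog]
  ring

/-- The product rule of `negMulLog` needs no positivity, so in this form the chain rule is pure
algebra, zero probabilities included. -/
lemma infoTerm_eq_negMulLog {a b : ℝ} (ha : 0 ≤ a) (hb : 0 ≤ b) : infoTerm a b =
    ((a + b) * Real.log 2 - Real.negMulLog a - Real.negMulLog b + Real.negMulLog (a + b)) /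
      (2 * Real.log 2) := by
  rw [infoTerm_eq_log, mul_log_two_mul_div ha hb, mul_log_two_mul_div hb ha, add_comm b a,
    Real.negMulLog.eq_def (a + b)]
  ring

lemma negMulLog_half (x : ℝ) : Real.negMulLog (x / 2) = Real.negMulLog x / 2 + x * Real.log 2 / 2 := by
  rw [div_eq_mul_inv, Real.negMulLog_mul, Real.negMulLog.eq_def 2⁻¹, Real.log_inv]; ring

/-- The chain rule for one polarization step, at a pair of outputs. -/
lemma infoTerm_chain {a b c d : ℝ} (ha : 0 ≤ a) (hb : 0 ≤ b) (hc : 0 ≤ c) (hd : 0 ≤ d) :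
    infoTerm ((a * c + b * d) / 2) ((b * c + a * d) / 2) +
      (infoTerm (a * c / 2) (b * d / 2) + infoTerm (b * c / 2) (a * d / 2)) =
    infoTerm a b * ((c + d) / 2) + (a + b) / 2 * infoTerm c d := by
  have hl : Real.log 2 ≠ 0 := (Real.log_pos one_lt_two).ne'
  have e : (a * c + b * d) / 2 + (b * c + a * d) / 2 = (a + b) * (c + d) / 2 := by ring
  rw [infoTerm_eq_negMulLog (by positivity) (by positivity),
    infoTerm_eq_negMulLog (by positivity) (by positivity),
    infoTerm_eq_negMulLog (by positivity) (by positivity), infoTerm_eq_negMulLog ha hb,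
    infoTerm_eq_negMulLog hc hd, ← add_div (a * c), ← add_div (b * c), e]
  simp only [negMulLog_half, Real.negMulLog_mul]
  field_simp
  ring

lemma Channel.symInfo_minus_add_plus : W.minus.symInfo + W.plus.symInfo = 2 * W.symInfo := by
  have h11 : (1 + 1 : ZMod 2) = 0 := rfl
  have h1 := hasSum_mul_prod W.hasSum_symInfo W.hasSum_outReal W.infoTerm_nonneg W.outReal_nonneg
  have h2 := hasSum_mul_prod W.hasSum_outReal W.hasSum_symInfo W.outReal_nonneg W.infoTerm_nonneg
  have h := (h1.add h2).sub W.minus.hasSum_symInfo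
  have h' : HasSum (fun y => infoTerm (W.plus.real 0 y) (W.plus.real 1 y))
      (W.symInfo * 1 + 1 * W.symInfo - W.minus.symInfo) := by
    refine hasSum_prod_zmod_two W.plus.infoTerm_nonneg ?_
    refine (congrArg (fun f => HasSum f _) (funext fun y => ?_)).mpr h
    have := infoTerm_chain (W.real_nonneg 0 y.1) (W.real_nonneg 1 y.1) (W.real_nonneg 0 y.2)
      (W.real_nonneg 1 y.2)
    simp only [Channel.plus_real, Channel.minus_real, Channel.outReal, zero_add, add_zero, h11]
    linarith
  have := h'.unique W.plus.hasSum_symInfo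
  linarith

end Real

/-! ### Averages over the polarization tree -/

section Tree

/-- The average of `Φ` over the `2 ^ n` channels obtained from `W` by `n` polarization steps. -/
def treeAvg (Φ : ∀ Y : Type u, Channel Y → ℝ) : ℕ → ∀ {Y : Type u}, Channel Y → ℝ
  | 0, Y, W => Φ Y W
  | n + 1, _, W => (treeAvg Φ n W.minus + treeAvg Φ n W.plus) / 2

variable {Φ Ψ : ∀ Y : Type u, Channel Y → ℝ}

lemma treeAvg_mono (h : ∀ Y V, Φ Y V ≤ Ψ Y V) :
    ∀ (n : ℕ) {Y : Type u} (W : Channel Y), treeAvg Φ n W ≤ treeAvg Ψ n W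
  | 0, _, W => h _ W
  | n + 1, _, W => by
    have h1 := treeAvg_mono h n W.minus
    have h2 := treeAvg_mono h n W.plus
    simp only [treeAvg]; linarith

lemma treeAvg_const (c : ℝ) :
    ∀ (n : ℕ) {Y : Type u} (W : Channel Y), treeAvg (fun _ _ => c) n W = c
  | 0, _, _ => rfl
  | n + 1, _, W => by simp only [treeAvg, treeAvg_const c n]; ring

lemma treeAvg_linear (a b : ℝ) : ∀ (n : ℕ) {Y : Type u} (W : Channel Y),
    treeAvg (fun Y V => Φ Y V + a + b * Ψ Y V) n W = treeAvg Φ n W + a + b * treeAvg Ψ n W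
  | 0, _, _ => rfl
  | n + 1, _, W => by
    simp only [treeAvg, treeAvg_linear a b n]; ring

lemma treeAvg_add_steps (k : ℕ) : ∀ (m : ℕ) {Y : Type u} (W : Channel Y),
    treeAvg Φ (m + k) W = treeAvg (fun _ V => treeAvg Φ k V) m W
  | 0, _, W => by rw [zero_add]; rfl
  | m + 1, _, W => by
    rw [Nat.add_right_comm]
    simp only [treeAvg, treeAvg_add_steps k m]

/-- A supermartingale argument: `Ψ` bounds from below the drop of `Φ` in one step, and the drops
telescope. -/
lemma treeAvg_add_sum_le (h : ∀ (Y : Type u) (V : Channel Y),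
      (Φ _ V.minus + Φ _ V.plus) / 2 + Ψ Y V ≤ Φ Y V) :
    ∀ (n : ℕ) {Y : Type u} (W : Channel Y),
      treeAvg Φ n W + ∑ k ∈ Finset.range n, treeAvg Ψ k W ≤ Φ Y W
  | 0, _, W => by simp [treeAvg]
  | n + 1, _, W => by
    have h1 := treeAvg_add_sum_le h n W.minus
    have h2 := treeAvg_add_sum_le h n W.plus
    have h3 := h _ W
    rw [Finset.sum_range_succ']
    simp only [treeAvg, ← Finset.sum_div, Finset.sum_add_distrib]
    linarith

/-- The averaged drops have total at most `Φ Y W` at every depth, so they cannot all exceed `ε`. No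
martingale convergence theorem is needed. -/
lemma exists_treeAvg_le (hΦ : ∀ Y V, 0 ≤ Φ Y V)
    (h : ∀ (Y : Type u) (V : Channel Y), (Φ _ V.minus + Φ _ V.plus) / 2 + Ψ Y V ≤ Φ Y V)
    {Y : Type u} (W : Channel Y) {ε : ℝ} (hε : 0 < ε) : ∃ m, treeAvg Ψ m W ≤ ε := by
  by_contra! hc
  obtain ⟨n, hn⟩ := exists_nat_gt (Φ Y W / ε)
  have h1 := treeAvg_add_sum_le h n W
  have h2 : 0 ≤ treeAvg Φ n W := by
    rw [← treeAvg_const 0 n W]; exact treeAvg_mono hΦ n W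
  have h3 : ∑ k ∈ Finset.range n, ε ≤ ∑ k ∈ Finset.range n, treeAvg Ψ k W :=
    Finset.sum_le_sum fun k _ => (hc k).le
  rw [div_lt_iff₀ hε] at hn
  simp only [Finset.sum_const, Finset.card_range, nsmul_eq_mul] at h3
  linarith

end Tree

/-! ### Polarization -/

lemma treeAvg_symInfo : ∀ (n : ℕ) {Y : Type u} (W : Channel Y),
    treeAvg (fun _ V => V.symInfo) n W = W.symInfo
  | 0, _, _ => rfl
  | n + 1, _, W => by
    simp only [treeAvg, treeAvg_symInfo n]
    linarith [W.symInfo_minus_add_plus]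

/-- With s = √z and t = √(2 - z), the average on the left is at most s(s + t)/2. Here (s + t)² = 2 +
2st and (st)² = 1 - (1 - z)², so s + t falls short of 2 by a multiple of (1 - z)². -/
lemma sqrt_bhatt_step {Y : Type u} (V : Channel Y) :
    (√V.minus.bhatt + √V.plus.bhatt) / 2 + √V.bhatt * (1 - V.bhatt) ^ 2 / 8 ≤ √V.bhatt := by
  have h0 := V.bhatt_nonneg
  have h1 := V.bhatt_le_one
  rw [V.bhatt_plus, Real.sqrt_sq h0]
  set z := V.bhatt
  have hm : √V.minus.bhatt ≤ √z * √(2 - z) := by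
    rw [← Real.sqrt_mul h0]
    exact Real.sqrt_le_sqrt (by linarith [V.bhatt_minus_le])
  have hs : √z ^ 2 = z := Real.sq_sqrt h0
  have ht : √(2 - z) ^ 2 = 2 - z := Real.sq_sqrt (by linarith)
  have hs0 := Real.sqrt_nonneg z
  have ht0 := Real.sqrt_nonneg (2 - z)
  set s := √z
  set t := √(2 - z)
  have hst : s * t ≤ 1 - (1 - z) ^ 2 / 2 := by
    refine abs_le_of_sq_le_sq' ?_ (by nlinarith) |>.2
    rw [mul_pow, hs, ht]; nlinarith [sq_nonneg ((1 - z) ^ 2)]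
  have hsum : s + t ≤ 2 - (1 - z) ^ 2 / 4 := by
    refine abs_le_of_sq_le_sq' ?_ (by nlinarith) |>.2
    nlinarith [sq_nonneg ((1 - z) ^ 2)]
  have : s * (s + t) ≤ s * (2 - (1 - z) ^ 2 / 4) := mul_le_mul_of_nonneg_left hsum hs0
  nlinarith

open Classical in
/-- The fraction of the channels after `n` polarization steps whose Bhattacharyya parameter is
at most `t`. -/
def goodFrac (t : ℝ) (n : ℕ) {Y : Type u} (W : Channel Y) : ℝ :=
  treeAvg (fun _ V => if V.bhatt ≤ t then 1 else 0) n W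

lemma goodFrac_nonneg (t : ℝ) (n : ℕ) {Y : Type u} (W : Channel Y) : 0 ≤ goodFrac t n W := by
  rw [← treeAvg_const 0 n W]
  exact treeAvg_mono (fun _ V => by split_ifs <;> norm_num) n W

/-- Channels that are already good get better quickly, except for a small fraction. -/
lemma one_sub_goodFrac_le {t c : ℝ} (hc : 0 ≤ c) (ht : ∀ z, t < z → 1 ≤ √√z * c) :
    ∀ (k : ℕ) {Y : Type u} (W : Channel Y),
      1 - goodFrac t k W ≤ √√W.bhatt * ((7 / 10) ^ k * c + 8)
  | 0, _, W => by
    have h0 := Real.sqrt_nonneg (√W.bhatt)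
    simp only [goodFrac, treeAvg]
    split_ifs with h
    · simp only [sub_self]; positivity
    · have := ht _ (not_le.mp h)
      simp only [pow_zero, one_mul, sub_zero]; nlinarith
  | k + 1, _, W => by
    have h0 := Real.sqrt_nonneg (√W.bhatt)
    have hz := W.bhatt_nonneg
    have hk : 0 ≤ (7 / 10 : ℝ) ^ k * c := by positivity
    have hk' : 0 ≤ (7 / 10 : ℝ) ^ (k + 1) * c := by positivity
    by_cases hq : √√W.bhatt ≤ 1 / 8
    -- Write q = Z^(1/4). The minus step multiplies q by at most 2^(1/4) < 6/5, the plus step by q ≤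
    -- 1/8; the mean factor (6/5 + 1/8)/2 is below 7/10.
    · have h1 := one_sub_goodFrac_le hc ht k W.minus
      have h2 := one_sub_goodFrac_le hc ht k W.plus
      have e : goodFrac t (k + 1) W = (goodFrac t k W.minus + goodFrac t k W.plus) / 2 := rfl
      have hp : √√W.plus.bhatt = √√W.bhatt * √√W.bhatt := by
        rw [W.bhatt_plus, Real.sqrt_sq hz, Real.mul_self_sqrt (Real.sqrt_nonneg _)]
      have hm : √√W.minus.bhatt ≤ 6 / 5 * √√W.bhatt := by
        refine Real.sqrt_le_iff.mpr ⟨by positivity, Real.sqrt_le_iff.mpr ⟨by positivity, ?_⟩⟩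
        rw [mul_pow, mul_pow, Real.sq_sqrt (Real.sqrt_nonneg _), Real.sq_sqrt hz]
        nlinarith [W.bhatt_minus_le]
      rw [e]
      rw [hp] at h2
      have h3 : √√W.minus.bhatt * ((7 / 10) ^ k * c + 8) ≤
          6 / 5 * √√W.bhatt * ((7 / 10) ^ k * c + 8) :=
        mul_le_mul_of_nonneg_right hm (by positivity)
      have h4 : √√W.bhatt * √√W.bhatt * ((7 / 10) ^ k * c + 8) ≤
          1 / 8 * √√W.bhatt * ((7 / 10) ^ k * c + 8) :=
        mul_le_mul_of_nonneg_right (mul_le_mul_of_nonneg_right hq h0) (by positivity)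
      have h5 : 0 ≤ √√W.bhatt * ((7 / 10) ^ k * c) := by positivity
      rw [pow_succ]
      nlinarith
    -- Here 8q > 1 and the bound is trivial; this is what the summand 8 is for.
    · have := goodFrac_nonneg t (k + 1) W
      nlinarith

/-- Each of the three terms covers one case: Z ≤ δ, Z ≥ 1 - η, and the unpolarized range in between,
where the drop of √Z is bounded below. -/
lemma polarization_pointwise {Y : Type u} (V : Channel Y) {δ η : ℝ} (hδ : 0 < δ) (hη : 0 < η) :
    V.symInfo ≤ (if V.bhatt ≤ δ then 1 else 0) + 4 * η +
      8 / (√δ * η ^ 2) * (√V.bhatt * (1 - V.bhatt) ^ 2 / 8) := by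
  have h1 := V.bhatt_le_one
  have hI := V.symInfo_le_one
  have hpos : 0 ≤ 8 / (√δ * η ^ 2) * (√V.bhatt * (1 - V.bhatt) ^ 2 / 8) := by positivity
  split_ifs with h
  · linarith
  by_cases h2 : 1 - V.bhatt ≤ η
  · linarith [V.symInfo_le_bhatt]
  · have hs : √δ ≤ √V.bhatt := Real.sqrt_le_sqrt (not_le.mp h).le
    have hq : η ^ 2 ≤ (1 - V.bhatt) ^ 2 := pow_le_pow_left₀ hη.le (not_le.mp h2).le 2
    have hd : 0 < √δ := Real.sqrt_pos.mpr hδ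
    have : √δ * η ^ 2 ≤ √V.bhatt * (1 - V.bhatt) ^ 2 := by gcongr
    have : 1 ≤ 8 / (√δ * η ^ 2) * (√V.bhatt * (1 - V.bhatt) ^ 2 / 8) := by
      rw [div_mul_div_comm, le_div_iff₀ (by positivity)]; linarith
    linarith

/-- The fraction of the polarized channels with a Bhattacharyya parameter at most `4 ^ (-n)` is
asymptotically at least the mutual information under the uniform input. -/
theorem exists_forall_le_goodFrac {Y : Type u} (W : Channel Y) {η : ℝ} (hη : 0 < η) :
    ∃ n₀ : ℕ, ∀ n ≥ n₀, W.symInfo - η ≤ goodFrac ((1 / 4) ^ n) n W := by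
  classical
  -- The loss η is split into three thirds: 4 · η/12 from channels with Z near 1, η/3 from
  -- unpolarized ones, and 9 · η/27 from good channels that fail to improve, where 9 = 1 + 8.
  set δ : ℝ := (η / 27) ^ 4 with hδ
  have hδ0 : 0 < δ := by positivity
  have hδs : √√δ = η / 27 := by
    have : δ = ((η / 27) ^ 2) ^ 2 := by rw [hδ]; ring
    rw [this, Real.sqrt_sq (by positivity), Real.sqrt_sq (by positivity)]
  have hM : 0 < 8 / (√δ * (η / 12) ^ 2) := by positivity
  obtain ⟨m, hm⟩ := exists_treeAvg_le (Φ := fun _ V => √V.bhatt)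
    (Ψ := fun _ V => √V.bhatt * (1 - V.bhatt) ^ 2 / 8) (fun _ V => Real.sqrt_nonneg _)
    (fun _ V => sqrt_bhatt_step V) W (ε := η / 3 / (8 / (√δ * (η / 12) ^ 2))) (by positivity)
  have hI := treeAvg_mono (fun _ V => polarization_pointwise V hδ0 (η := η / 12) (by positivity)) m W
  rw [treeAvg_symInfo, treeAvg_linear] at hI
  rw [le_div_iff₀ hM, mul_comm] at hm
  have h2 : √2 * √2 = (2 : ℝ) := Real.mul_self_sqrt (by norm_num)
  have hs2 : 0 < √(2 : ℝ) := by positivity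
  -- The threshold 4^(-n) has fourth root √2^(-n), so `one_sub_goodFrac_le` is used with c = √2^(m +
  -- k). As 7/10 · √2 < 1 and `m` is fixed, the contraction wins.
  have hlim : Filter.Tendsto (fun k : ℕ => √2 ^ m * (7 / 10 * √2) ^ k) Filter.atTop (nhds 0) := by
    rw [← mul_zero (√2 ^ m)]
    exact (tendsto_pow_atTop_nhds_zero_of_lt_one (by positivity) (by nlinarith)).const_mul _
  obtain ⟨k₀, hk₀⟩ := Filter.eventually_atTop.mp (hlim.eventually_le_const one_pos)
  refine ⟨m + k₀, fun n hn => ?_⟩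
  obtain ⟨k, rfl⟩ : ∃ k, n = m + k := ⟨n - m, by omega⟩
  have hk := hk₀ k (by omega)
  have ht (z : ℝ) (hz : (1 / 4 : ℝ) ^ (m + k) < z) : 1 ≤ √√z * √2 ^ (m + k) := by
    rw [← div_le_iff₀ (by positivity)]
    refine Real.le_sqrt_of_sq_le (Real.le_sqrt_of_sq_le (hz.le.trans' (le_of_eq ?_)))
    rw [div_pow, div_pow, ← pow_mul, ← pow_mul, pow_right_comm]
    have : √2 ^ (2 * 2) = (4 : ℝ) := by rw [pow_mul, Real.sq_sqrt (by norm_num)]; norm_num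
    rw [this]; simp
  -- The null summand gives the left side the shape required by `treeAvg_linear`.
  have key : ∀ (X : Type u) (V : Channel X), (if V.bhatt ≤ δ then 1 else 0) + -(η / 3) + 0 * (0 : ℝ) ≤
      goodFrac ((1 / 4) ^ (m + k)) k V := by
    intro X V
    have hb := one_sub_goodFrac_le (by positivity) ht k V
    have hg := goodFrac_nonneg ((1 / 4) ^ (m + k)) k V
    split_ifs with h
    · have hV : √√V.bhatt ≤ η / 27 := hδs ▸ Real.sqrt_le_sqrt (Real.sqrt_le_sqrt h)
      have e : (7 / 10) ^ k * √2 ^ (m + k) = √2 ^ m * (7 / 10 * √2) ^ k := by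
        rw [mul_pow, pow_add]; ring
      rw [e] at hb
      have : √√V.bhatt * (√2 ^ m * (7 / 10 * √2) ^ k + 8) ≤ η / 27 * 9 := by
        gcongr; linarith
      linarith
    · linarith
  have hfin := treeAvg_mono (Ψ := fun _ V => goodFrac ((1 / 4) ^ (m + k)) k V) key m W
  rw [treeAvg_linear] at hfin
  rw [goodFrac, treeAvg_add_steps]
  change _ ≤ treeAvg (fun _ V => goodFrac ((1 / 4) ^ (m + k)) k V) m W
  linarith

/-! ### Bhattacharyya parameters of the polarized channels -/

/-- The Bhattacharyya parameter of the `i`-th polarized channel. -/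
def polarBhatt : ∀ (n : ℕ) {Y : Type u}, Channel Y → Fin (2 ^ n) → ℝ
  | 0, _, W, _ => W.bhatt
  | n + 1, _, W, i =>
    Sum.elim (polarBhatt n W.minus) (polarBhatt n W.plus) ((halfEquiv n).symm i)

lemma polarBhatt_lo {n : ℕ} {Y : Type u} (W : Channel Y) (i : Fin (2 ^ n)) :
    polarBhatt (n + 1) W (lo i) = polarBhatt n W.minus i := by
  have : (halfEquiv n).symm (lo i) = Sum.inl i := (halfEquiv n).symm_apply_eq.mpr rfl
  rw [polarBhatt, this]; rfl

lemma polarBhatt_hi {n : ℕ} {Y : Type u} (W : Channel Y) (i : Fin (2 ^ n)) :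
    polarBhatt (n + 1) W (hi i) = polarBhatt n W.plus i := by
  have : (halfEquiv n).symm (hi i) = Sum.inr i := (halfEquiv n).symm_apply_eq.mpr rfl
  rw [polarBhatt, this]; rfl

lemma sum_polarBhatt (φ : ℝ → ℝ) : ∀ (n : ℕ) {Y : Type u} (W : Channel Y),
    ∑ i, φ (polarBhatt n W i) = 2 ^ n * treeAvg (fun _ V => φ V.bhatt) n W
  | 0, _, W => by
    simp only [polarBhatt, treeAvg]
    simp
  | n + 1, _, W => by
    simp only [sum_half, polarBhatt_lo, polarBhatt_hi, sum_polarBhatt φ n, treeAvg]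
    ring

open Classical in
/-- The indices whose polarized channels have a Bhattacharyya parameter at most `4 ^ (-n)`. -/
def goodSet (n : ℕ) {Y : Type u} (W : Channel Y) : Finset (Fin (2 ^ n)) :=
  {i | polarBhatt n W i ≤ (1 / 4) ^ n}

lemma card_goodSet (n : ℕ) {Y : Type u} (W : Channel Y) :
    ((goodSet n W).card : ℝ) = 2 ^ n * goodFrac ((1 / 4) ^ n) n W := by
  classical
  rw [goodFrac, ← sum_polarBhatt (fun z => if z ≤ (1 / 4) ^ n then 1 else 0) n W, goodSet,
    Finset.card_filter]
  push_cast
  exact Finset.sum_congr rfl fun i _ => by congr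

/-! ### Degradation -/

/-- `V` is obtained from `W` by processing its output. -/
def Channel.IsDegradedOf {Y Y' : Type*} (V : Channel Y') (W : Channel Y) : Prop :=
  ∃ Q : Y → PMF Y', ∀ x, V x = (W x).bind Q

section Degraded

variable {Y Y' : Type*} {V : Channel Y'} {W : Channel Y}

lemma Channel.IsDegradedOf.minus (h : V.IsDegradedOf W) : V.minus.IsDegradedOf W.minus := by
  obtain ⟨Q, hQ⟩ := h
  refine ⟨fun y => (Q y.1).bind fun z => (Q y.2).map (Prod.mk z), fun x => ?_⟩
  simp only [Channel.minus, hQ, PMF.bind_bind, PMF.map_bind, PMF.bind_map, Function.comp_def]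
  congr 1; funext v; congr 1; funext y
  rw [PMF.bind_comm]

lemma Channel.IsDegradedOf.plus (h : V.IsDegradedOf W) : V.plus.IsDegradedOf W.plus := by
  obtain ⟨Q, hQ⟩ := h
  refine ⟨fun y => ((Q y.1.1).bind fun z => (Q y.1.2).map (Prod.mk z)).map fun p => (p, y.2),
    fun x => ?_⟩
  simp only [Channel.plus, hQ, PMF.bind_bind, PMF.map_bind, PMF.bind_map, Function.comp_def]
  congr 1; funext v; congr 1; funext y
  rw [PMF.bind_comm]

lemma ofReal_bhatt (W : Channel Y) :
    ENNReal.ofReal W.bhatt = ∑' y, W 0 y ^ (1 / 2 : ℝ) * W 1 y ^ (1 / 2 : ℝ) := by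
  rw [Channel.bhatt, ENNReal.ofReal_tsum_of_nonneg W.bhattTerm_nonneg W.summable_bhattTerm]
  refine tsum_congr fun y => ?_
  rw [Channel.bhattTerm, ENNReal.ofReal_mul (Real.sqrt_nonneg _), Real.sqrt_eq_rpow,
    Real.sqrt_eq_rpow, ← ENNReal.ofReal_rpow_of_nonneg (W.real_nonneg _ _) (by norm_num),
    ← ENNReal.ofReal_rpow_of_nonneg (W.real_nonneg _ _) (by norm_num), W.ofReal_real,
    W.ofReal_real]

lemma tsum_rpow_half_mul_le {α : Type*} (f g : α → ℝ≥0∞) :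
    ∑' a, f a ^ (1 / 2 : ℝ) * g a ^ (1 / 2 : ℝ) ≤
      (∑' a, f a) ^ (1 / 2 : ℝ) * (∑' a, g a) ^ (1 / 2 : ℝ) := by
  rw [ENNReal.tsum_eq_iSup_sum]
  refine iSup_le fun s => ?_
  have := ENNReal.inner_le_Lp_mul_Lq s (fun a => f a ^ (1 / 2 : ℝ)) (fun a => g a ^ (1 / 2 : ℝ))
    (p := 2) (q := 2) (by constructor <;> norm_num)
  simp only [← ENNReal.rpow_mul] at this
  norm_num at this
  norm_num
  refine this.trans ?_
  gcongr <;> exact ENNReal.sum_le_tsum s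

/-- Splitting each output y of `W` into pairs (y, z) does not change Z; merging all pairs with the
same z increases it, by Cauchy–Schwarz. -/
lemma Channel.IsDegradedOf.bhatt_le (h : V.IsDegradedOf W) : W.bhatt ≤ V.bhatt := by
  obtain ⟨Q, hQ⟩ := h
  rw [← ENNReal.ofReal_le_ofReal_iff V.bhatt_nonneg, ofReal_bhatt, ofReal_bhatt]
  calc ∑' y, W 0 y ^ (1 / 2 : ℝ) * W 1 y ^ (1 / 2 : ℝ)
      = ∑' y, ∑' z, (W 0 y * Q y z) ^ (1 / 2 : ℝ) * (W 1 y * Q y z) ^ (1 / 2 : ℝ) := by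
        refine tsum_congr fun y => ?_
        have (z : Y') : (W 0 y * Q y z) ^ (1 / 2 : ℝ) * (W 1 y * Q y z) ^ (1 / 2 : ℝ) =
            W 0 y ^ (1 / 2 : ℝ) * W 1 y ^ (1 / 2 : ℝ) * Q y z := by
          rw [ENNReal.mul_rpow_of_nonneg _ _ (by norm_num),
            ENNReal.mul_rpow_of_nonneg _ _ (by norm_num), mul_mul_mul_comm,
            ← ENNReal.rpow_add_of_nonneg (x := Q y z) _ _ (by norm_num) (by norm_num)]
          norm_num
        simp only [this, ENNReal.tsum_mul_left, (Q y).tsum_coe, mul_one]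
    _ = ∑' z, ∑' y, (W 0 y * Q y z) ^ (1 / 2 : ℝ) * (W 1 y * Q y z) ^ (1 / 2 : ℝ) :=
        ENNReal.tsum_comm
    _ ≤ ∑' z, V 0 z ^ (1 / 2 : ℝ) * V 1 z ^ (1 / 2 : ℝ) := by
        refine ENNReal.tsum_le_tsum fun z => ?_
        simp only [hQ, PMF.bind_apply]
        exact tsum_rpow_half_mul_le _ _

end Degraded

lemma polarBhatt_le_of_isDegradedOf : ∀ (n : ℕ) {Y : Type*} {Y' : Type*} {V : Channel Y'}
    {W : Channel Y}, V.IsDegradedOf W → ∀ i, polarBhatt n W i ≤ polarBhatt n V i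
  | 0, _, _, _, _, h, _ => h.bhatt_le
  | n + 1, _, _, V, W, h, i => by
    revert i
    rw [forall_half]
    simp only [polarBhatt_lo, polarBhatt_hi]
    exact ⟨polarBhatt_le_of_isDegradedOf n h.minus, polarBhatt_le_of_isDegradedOf n h.plus⟩

lemma goodSet_subset_of_isDegradedOf (n : ℕ) {Y Y' : Type*} {V : Channel Y'} {W : Channel Y}
    (h : V.IsDegradedOf W) : goodSet n V ⊆ goodSet n W := by
  intro i
  simp only [goodSet, Finset.mem_filter, Finset.mem_univ, true_and]
  exact (polarBhatt_le_of_isDegradedOf n h i).trans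

/-! ### Likelihoods under the polarized channels -/

section Likelihood

variable {n : ℕ} {Y : Type*}

/-- The polarized channel without its normalization. -/
def likelihood (W : Channel Y) (i : Fin (2 ^ n)) (y : Fin (2 ^ n) → Y)
    (u : Fin (2 ^ n) → ZMod 2) (b : ZMod 2) : ℝ≥0∞ :=
  ∑ v : Fin (2 ^ n) → ZMod 2,
    if (∀ j, j < i → v j = u j) ∧ v i = b then blockProb W (polarEncode v) y else 0

lemma polarizedChannel_eq (W : Channel Y) (i : Fin (2 ^ n)) (y : Fin (2 ^ n) → Y)
    (u : Fin (2 ^ n) → ZMod 2) (b : ZMod 2) :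
    polarizedChannel W i y u b = ((2 : ℝ≥0∞) ^ (2 ^ n - 1))⁻¹ * likelihood W i y u b := by
  rw [polarizedChannel, likelihood, Finset.sum_filter, Finset.mul_sum]
  exact Finset.sum_congr rfl fun v _ => by split_ifs <;> simp

lemma polarizedChannel_le_iff (W : Channel Y) (i : Fin (2 ^ n)) (y : Fin (2 ^ n) → Y)
    (u : Fin (2 ^ n) → ZMod 2) (b c : ZMod 2) :
    polarizedChannel W i y u b ≤ polarizedChannel W i y u c ↔
      likelihood W i y u b ≤ likelihood W i y u c := by
  rw [polarizedChannel_eq, polarizedChannel_eq]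
  exact ENNReal.mul_le_mul_iff_right (by simp) (by simp)

lemma likelihood_congr (W : Channel Y) (i : Fin (2 ^ n)) (y : Fin (2 ^ n) → Y)
    {u u' : Fin (2 ^ n) → ZMod 2} (h : ∀ j, j < i → u j = u' j) (b : ZMod 2) :
    likelihood W i y u b = likelihood W i y u' b := by
  refine Finset.sum_congr rfl fun v _ => ?_
  have : (∀ j, j < i → v j = u j) ↔ ∀ j, j < i → v j = u' j :=
    forall₂_congr fun j hj => by rw [h j hj]
  simp only [this]

lemma sum_pi_prod {m : ℕ} (f : Fin m → ZMod 2 → ℝ≥0∞) :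
    ∑ x : Fin m → ZMod 2, ∏ j, f j (x j) = ∏ j, ∑ b, f j b := by
  rw [Finset.prod_univ_sum, Fintype.piFinset_univ]

lemma blockProb_encode_succ (W : Channel Y) (v : Fin (2 ^ (n + 1)) → ZMod 2)
    (y : Fin (2 ^ (n + 1)) → Y) :
    blockProb W (polarEncode v) y =
      ∏ j, (W (polarEncode (v ∘ lo) j + polarEncode (v ∘ hi) j) (y (ev j)) *
        W (polarEncode (v ∘ hi) j) (y (od j))) := by
  simp only [blockProb, prod_parity, polarEncode_ev, polarEncode_od]

/-- The polar transform permutes the words, so the sum runs over all inputs and factors over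
coordinates. Each coordinate contributes 2, undoing the factor 1/2 in `W.minus`. -/
lemma sum_blockProb_minus (W : Channel Y) (a : Fin (2 ^ n) → ZMod 2)
    (y : Fin (2 ^ n) → Y × Y) :
    ∑ v : Fin (2 ^ n) → ZMod 2,
      ∏ j, (W (a j + polarEncode v j) (y j).1 * W (polarEncode v j) (y j).2) =
      2 ^ 2 ^ n * blockProb W.minus a y := by
  have h := (encodeEquiv n).sum_comp
    fun x : Fin (2 ^ n) → ZMod 2 => ∏ j, (W (a j + x j) (y j).1 * W (x j) (y j).2)
  simp only [encodeEquiv_apply] at h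
  rw [h, sum_pi_prod fun j b => W (a j + b) (y j).1 * W b (y j).2]
  have e (j : Fin (2 ^ n)) : ∑ b, W (a j + b) (y j).1 * W b (y j).2 = 2 * W.minus (a j) (y j) := by
    rw [Channel.minus_apply, ← mul_assoc, ENNReal.mul_inv_cancel (by simp) (by simp), one_mul]
  simp only [e, Finset.prod_mul_distrib, Finset.prod_const, Finset.card_univ, Fintype.card_fin,
    blockProb]

lemma prod_eq_blockProb_plus (W : Channel Y) (a b : Fin (2 ^ n) → ZMod 2)
    (y : Fin (2 ^ n) → Y × Y) :
    ∏ j, (W (a j + b j) (y j).1 * W (b j) (y j).2) =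
      2 ^ 2 ^ n * blockProb W.plus b (fun j => (y j, a j)) := by
  have e (j : Fin (2 ^ n)) : W (a j + b j) (y j).1 * W (b j) (y j).2 =
      2 * W.plus (b j) (y j, a j) := by
    rw [Channel.plus_apply, ← mul_assoc, ENNReal.mul_inv_cancel (by simp) (by simp), one_mul]
  simp only [e, Finset.prod_mul_distrib, Finset.prod_const, Finset.card_univ, Fintype.card_fin,
    blockProb]

lemma sum_splitHalf {M : Type*} [AddCommMonoid M]
    (f : (Fin (2 ^ n) → ZMod 2) → (Fin (2 ^ n) → ZMod 2) → M) :
    ∑ v : Fin (2 ^ (n + 1)) → ZMod 2, f (v ∘ lo) (v ∘ hi) = ∑ v₁, ∑ v₂, f v₁ v₂ := by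
  rw [← Fintype.sum_prod_type', ← (splitHalf n (ZMod 2)).sum_comp]; rfl

/-- For an index in the first half the whole second half of the word is summed out, which produces
`W.minus`. -/
lemma likelihood_lo (W : Channel Y) (i : Fin (2 ^ n)) (y : Fin (2 ^ (n + 1)) → Y)
    (u : Fin (2 ^ (n + 1)) → ZMod 2) (b : ZMod 2) :
    likelihood W (lo i) y u b =
      2 ^ 2 ^ n * likelihood W.minus i (splitPairs n Y y) (u ∘ lo) b := by
  simp only [likelihood, blockProb_encode_succ, forall_half, lo_lt_lo, not_hi_lt_lo,
    false_imp_iff, forall_const, and_true]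
  refine (sum_splitHalf fun v₁ v₂ => if (∀ j, j < i → v₁ j = u (lo j)) ∧ v₁ i = b then
    ∏ j, (W (polarEncode v₁ j + polarEncode v₂ j) (y (ev j)) *
        W (polarEncode v₂ j) (y (od j))) else 0).trans ?_
  rw [Finset.mul_sum]
  refine Finset.sum_congr rfl fun v _ => ?_
  by_cases h : (∀ j, j < i → v j = u (lo j)) ∧ v i = b
  · simp only [if_pos h, Function.comp]
    exact sum_blockProb_minus W (polarEncode v) (splitPairs n Y y)
  · simp [h]

/-- For an index in the second half the first half is already known, and its encoding serves as the
extra output bits of `W.plus`. -/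
lemma likelihood_hi (W : Channel Y) (i : Fin (2 ^ n)) (y : Fin (2 ^ (n + 1)) → Y)
    (u : Fin (2 ^ (n + 1)) → ZMod 2) (b : ZMod 2) :
    likelihood W (hi i) y u b =
      2 ^ 2 ^ n * likelihood W.plus i
        (fun j => (splitPairs n Y y j, polarEncode (u ∘ lo) j)) (u ∘ hi) b := by
  simp only [likelihood, blockProb_encode_succ, forall_half, hi_lt_hi, lo_lt_hi, true_imp_iff]
  refine (sum_splitHalf fun v₁ v₂ => if ((∀ j, v₁ j = u (lo j)) ∧ ∀ j, j < i → v₂ j = u (hi j)) ∧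
    v₂ i = b then ∏ j, (W (polarEncode v₁ j + polarEncode v₂ j) (y (ev j)) *
        W (polarEncode v₂ j) (y (od j))) else 0).trans ?_
  rw [Finset.sum_eq_single (u ∘ lo), Finset.mul_sum]
  · refine Finset.sum_congr rfl fun v _ => ?_
    simp only [Function.comp, implies_true, true_and, mul_ite, mul_zero]
    congr 1
    exact prod_eq_blockProb_plus W (polarEncode (u ∘ lo)) (polarEncode v) (splitPairs n Y y)
  · intro v _ hv
    refine Finset.sum_eq_zero fun v' _ => if_neg fun h => hv (funext h.1.1)
  · simp

/-! ### Errors in single bits -/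

open Classical in
/-- The probability, when the word `u` is sent, that the wrong value of the `i`-th bit is at least
as likely as the right one, given the outputs and the previous bits. -/
def bitError (W : Channel Y) (i : Fin (2 ^ n)) (u : Fin (2 ^ n) → ZMod 2) : ℝ≥0∞ :=
  ∑' y, if likelihood W i y u (u i) ≤ likelihood W i y u (u i + 1) then
    blockProb W (polarEncode u) y else 0

lemma sum_bitError_lo (W : Channel Y) (i : Fin (2 ^ n)) :
    ∑ u, bitError W (lo i) u = 2 ^ 2 ^ n * ∑ u, bitError W.minus i u := by
  classical
  have h2 : (2 : ℝ≥0∞) ^ 2 ^ n ≠ 0 := by simp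
  have h2' : (2 : ℝ≥0∞) ^ 2 ^ n ≠ ∞ := by simp
  have e (u : Fin (2 ^ (n + 1)) → ZMod 2) : bitError W (lo i) u =
      ∑' y, if likelihood W.minus i y (u ∘ lo) ((u ∘ lo) i) ≤
        likelihood W.minus i y (u ∘ lo) ((u ∘ lo) i + 1) then
      ∏ j, (W (polarEncode (u ∘ lo) j + polarEncode (u ∘ hi) j) (y j).1 *
        W (polarEncode (u ∘ hi) j) (y j).2) else 0 := by
    rw [bitError, ← (splitPairs n Y).tsum_eq]
    simp only [likelihood_lo, ENNReal.mul_le_mul_iff_right h2 h2', blockProb_encode_succ]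
    rfl
  simp only [e]
  rw [sum_splitHalf fun u₁ u₂ => ∑' y, if likelihood W.minus i y u₁ (u₁ i) ≤
        likelihood W.minus i y u₁ (u₁ i + 1) then
      ∏ j, (W (polarEncode u₁ j + polarEncode u₂ j) (y j).1 *
        W (polarEncode u₂ j) (y j).2) else 0, Finset.mul_sum]
  refine Finset.sum_congr rfl fun u _ => ?_
  rw [← Summable.tsum_finsetSum fun _ _ => ENNReal.summable, bitError, ← ENNReal.tsum_mul_left]
  refine tsum_congr fun y => ?_
  split_ifs
  · exact sum_blockProb_minus W (polarEncode u) y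
  · simp

lemma sum_bitError_hi (W : Channel Y) (i : Fin (2 ^ n)) :
    ∑ u, bitError W (hi i) u = 2 ^ 2 ^ n * ∑ u, bitError W.plus i u := by
  classical
  have h2 : (2 : ℝ≥0∞) ^ 2 ^ n ≠ 0 := by simp
  have h2' : (2 : ℝ≥0∞) ^ 2 ^ n ≠ ∞ := by simp
  let T (u : Fin (2 ^ n) → ZMod 2) (y : Fin (2 ^ n) → (Y × Y) × ZMod 2) : ℝ≥0∞ :=
    if likelihood W.plus i y u (u i) ≤ likelihood W.plus i y u (u i + 1) then
      blockProb W.plus (polarEncode u) y else 0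
  have e (u : Fin (2 ^ (n + 1)) → ZMod 2) : bitError W (hi i) u =
      ∑' y : Fin (2 ^ n) → Y × Y, 2 ^ 2 ^ n * T (u ∘ hi) (fun j => (y j, polarEncode (u ∘ lo) j)) := by
    rw [bitError, ← (splitPairs n Y).tsum_eq]
    refine tsum_congr fun y => ?_
    simp only [T, likelihood_hi, ENNReal.mul_le_mul_iff_right h2 h2', blockProb_encode_succ,
      mul_ite, mul_zero, ← prod_eq_blockProb_plus]
    rfl
  simp only [e]
  rw [sum_splitHalf fun u₁ u₂ => ∑' y : Fin (2 ^ n) → Y × Y,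
    2 ^ 2 ^ n * T u₂ (fun j => (y j, polarEncode u₁ j)), Finset.sum_comm, Finset.mul_sum]
  refine Finset.sum_congr rfl fun u _ => ?_
  have h := (encodeEquiv n).sum_comp
    fun x : Fin (2 ^ n) → ZMod 2 =>
      ∑' y : Fin (2 ^ n) → Y × Y, 2 ^ 2 ^ n * T u (fun j => (y j, x j))
  simp only [encodeEquiv_apply] at h
  rw [h, ← Summable.tsum_finsetSum fun _ _ => ENNReal.summable, bitError,
    ← ENNReal.tsum_mul_left,
    ← (Equiv.arrowProdEquivProdArrow (Fin (2 ^ n)) (fun _ => Y × Y) fun _ => ZMod 2).symm.tsum_eq,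
    ENNReal.tsum_prod']
  refine tsum_congr fun y => ?_
  rw [tsum_fintype]
  rfl

lemma bitError_zero_le (W : Channel Y) (i : Fin (2 ^ 0)) (u : Fin (2 ^ 0) → ZMod 2) :
    bitError W i u ≤ ENNReal.ofReal W.bhatt := by
  classical
  have hi (j : Fin (2 ^ 0)) : j = i := Subsingleton.elim (α := Fin 1) j i
  let _ : Unique (Fin (2 ^ 0)) := ⟨⟨i⟩, hi⟩
  have hl (y : Fin (2 ^ 0) → Y) (b : ZMod 2) : likelihood W i y u b = W b (y i) := by
    rw [likelihood, Finset.sum_eq_single fun _ => b]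
    · rw [if_pos ⟨fun j hj => absurd (hi j) hj.ne, rfl⟩, polarEncode_zero_length, blockProb,
        Fintype.prod_unique]
      rfl
    · intro v _ hv
      exact if_neg fun h => hv (funext fun j => by rw [hi j, h.2])
    · simp
  rw [bitError, ofReal_bhatt, ← (Equiv.funUnique (Fin (2 ^ 0)) Y).tsum_eq
    fun y => W 0 y ^ (1 / 2 : ℝ) * W 1 y ^ (1 / 2 : ℝ)]
  refine ENNReal.tsum_le_tsum fun y => ?_
  have hd : (Equiv.funUnique (Fin (2 ^ 0)) Y) y = y i := rfl
  simp only [hl, hd]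
  split_ifs with h
  · rw [polarEncode_zero_length, blockProb, Fintype.prod_unique]
    change W (u i) (y i) ≤ _
    -- An error means that the right value has the smaller likelihood p, and then p ≤ √(pq).
    have hh (p q : ℝ≥0∞) (hpq : p ≤ q) : p ≤ p ^ (1 / 2 : ℝ) * q ^ (1 / 2 : ℝ) := by
      calc p = p ^ (1 / 2 : ℝ) * p ^ (1 / 2 : ℝ) := by
            rw [← ENNReal.rpow_add_of_nonneg _ _ (by norm_num) (by norm_num)]; norm_num
        _ ≤ _ := by gcongr
    have h01 : ∀ b : ZMod 2, b = 0 ∨ b = 1 := by decide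
    rcases h01 (u i) with h0 | h0 <;> rw [h0] at h ⊢
    · exact hh _ _ (by simpa using h)
    · rw [mul_comm]; exact hh _ _ h
  · exact zero_le

/-- Averaging over all words makes the recursion close, since the synthetic channels are defined
with uniform bits. Symmetry of the synthetic channels is thus never needed. -/
lemma sum_bitError_le : ∀ (n : ℕ) {Y : Type u} (W : Channel Y) (i : Fin (2 ^ n)),
    ∑ u, bitError W i u ≤ 2 ^ 2 ^ n * ENNReal.ofReal (polarBhatt n W i)
  | 0, _, W, i => by
    refine (Finset.sum_le_sum fun u _ => bitError_zero_le W i u).trans (le_of_eq ?_)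
    rw [Finset.sum_const, Finset.card_univ, Fintype.card_fun, ZMod.card, Fintype.card_fin,
      nsmul_eq_mul]
    simp [polarBhatt]
  | n + 1, _, W, i => by
    revert i
    rw [forall_half]
    simp only [sum_bitError_lo, sum_bitError_hi, polarBhatt_lo, polarBhatt_hi]
    have e : (2 : ℝ≥0∞) ^ 2 ^ (n + 1) = 2 ^ 2 ^ n * 2 ^ 2 ^ n := by rw [← pow_add]; ring_nf
    simp only [e, mul_assoc]
    exact ⟨fun i => by gcongr; exact sum_bitError_le n _ i,
      fun i => by gcongr; exact sum_bitError_le n _ i⟩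

/-- For a symmetric channel, the error probability of a bit does not depend on the word sent. -/
lemma bitError_eq_of_isSymmetric {W : Channel Y} (hW : W.IsSymmetric) (i : Fin (2 ^ n))
    (u : Fin (2 ^ n) → ZMod 2) : bitError W i u = bitError W i 0 := by
  classical
  obtain ⟨π, hπ, hW⟩ := hW
  have h01 : ∀ b : ZMod 2, b = 0 ∨ b = 1 := by decide
  have h11 : (1 + 1 : ZMod 2) = 0 := rfl
  -- Flipping the outputs by `π` where the codeword has a 1 is a permutation of the outputs that
  -- translates codewords by that of `u`.
  let act (y : Fin (2 ^ n) → Y) : Fin (2 ^ n) → Y := fun j =>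
    if polarEncode u j = 0 then y j else π (y j)
  have hact : Function.Involutive act := fun y => funext fun j => by
    by_cases h : polarEncode u j = 0 <;> simp [act, h, hπ]
  have hP (x : Fin (2 ^ n) → ZMod 2) (y : Fin (2 ^ n) → Y) :
      blockProb W x (act y) = blockProb W (x + polarEncode u) y := by
    refine Finset.prod_congr rfl fun j _ => ?_
    rcases h01 (polarEncode u j) with h | h
    · simp [act, h]
    · rcases h01 (x j) with h' | h' <;> simp [act, h, h', h11, hW, hπ]
  have hL (y : Fin (2 ^ n) → Y) (b : ZMod 2) :
      likelihood W i (act y) u b = likelihood W i y 0 (b + u i) := by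
    rw [likelihood, likelihood, ← Equiv.sum_comp (Equiv.addRight u)]
    refine Finset.sum_congr rfl fun v _ => ?_
    have hc : (∀ j, j < i → v j + u j = u j) ∧ v i + u i = b ↔
        (∀ j, j < i → v j = 0) ∧ v i = b + u i := by
      have : v i + u i = b ↔ v i = b + u i := by
        generalize v i = p; generalize u i = q; revert p q b; decide
      simp [this]
    have huu : polarEncode u + polarEncode u = 0 := by
      funext j; exact CharTwo.add_self_eq_zero _
    simp only [Equiv.coe_addRight, Pi.add_apply, hc, hP, polarEncode_add, add_assoc, huu,
      add_zero, Pi.zero_apply]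
  rw [bitError, bitError, ← hact.toPerm.tsum_eq]
  refine tsum_congr fun y => ?_
  have huu : polarEncode u + polarEncode u = polarEncode 0 := by
    rw [← polarEncode_add]; congr 1; funext j; exact CharTwo.add_self_eq_zero _
  have hui : u i + u i = 0 := CharTwo.add_self_eq_zero _
  simp only [Function.Involutive.coe_toPerm, hL, hP, huu, add_right_comm (u i) 1, hui,
    Pi.zero_apply]

lemma bitError_le {Y : Type u} {W : Channel Y} (hW : W.IsSymmetric) (i : Fin (2 ^ n))
    (u : Fin (2 ^ n) → ZMod 2) : bitError W i u ≤ ENNReal.ofReal (polarBhatt n W i) := by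
  have h := sum_bitError_le n W i
  simp only [bitError_eq_of_isSymmetric hW i] at h ⊢
  rw [Finset.sum_const, Finset.card_univ, Fintype.card_fun, ZMod.card, Fintype.card_fin,
      nsmul_eq_mul] at h
  push_cast at h
  exact (ENNReal.mul_le_mul_iff_right (by simp) (by simp)).mp h

/-! ### Successive cancellation decoding -/

/-- The event that at some index of `S` the wrong bit is at least as likely as the right one. -/
def SCFailure (W : Channel Y) (S : Finset (Fin (2 ^ n))) (u : Fin (2 ^ n) → ZMod 2)
    (y : Fin (2 ^ n) → Y) : Prop :=
  ∃ i ∈ S, likelihood W i y u (u i) ≤ likelihood W i y u (u i + 1)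

/-- `SCFailure` refers to the true past bits, not to the decoded ones. Up to the first wrong
decision the two agree, so a decoding error implies a failure; counting ties as failures makes the
tie rule irrelevant. -/
lemma scDecode_eq {W : Channel Y} {S : Finset (Fin (2 ^ n))} {frozen u : Fin (2 ^ n) → ZMod 2}
    {y : Fin (2 ^ n) → Y} (hf : ∀ i ∉ S, frozen i = u i) (h : ¬ SCFailure W S u y) :
    scDecode W S frozen y = u := by
  funext i
  induction i using WellFoundedLT.induction with
  | ind i ih =>
    have hl := likelihood_congr W i y (u' := u)
      (u := fun j => if _h : j < i then scDecode W S frozen y j else 0)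
      fun j hj => by rw [dif_pos hj, ih j hj]
    rw [scDecode]
    simp only [polarizedChannel_le_iff, hl]
    split_ifs with hi hle
    · by_contra hne
      have hu : u i = 1 := by
        revert hne; generalize u i = b; revert b; decide
      exact h ⟨i, hi, by rw [hu]; exact hle⟩
    · by_contra hne
      have hu : u i = 0 := by
        revert hne; generalize u i = b; revert b; decide
      refine h ⟨i, hi, ?_⟩
      rw [hu, zero_add]
      exact (not_le.mp hle).le
    · exact hf i hi

-- Union bound: at most 2^n indices, each with error probability at most 4^(-n).
open Classical in
lemma tsum_scFailure_le {Y : Type u} {W : Channel Y} (hW : W.IsSymmetric)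
    {S : Finset (Fin (2 ^ n))} (hS : S ⊆ goodSet n W) (u : Fin (2 ^ n) → ZMod 2) :
    ∑' y, (if SCFailure W S u y then 1 else 0) * blockProb W (polarEncode u) y ≤
      ENNReal.ofReal ((1 / 2) ^ n) := by
  calc ∑' y, (if SCFailure W S u y then 1 else 0) * blockProb W (polarEncode u) y
      ≤ ∑' y, ∑ i ∈ S, if likelihood W i y u (u i) ≤ likelihood W i y u (u i + 1) then
          blockProb W (polarEncode u) y else 0 := by
        refine ENNReal.tsum_le_tsum fun y => ?_
        split_ifs with h
        · obtain ⟨i, hi, h⟩ := h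
          rw [one_mul]
          exact (le_of_eq (by rw [if_pos h])).trans (Finset.single_le_sum (f := fun i =>
            if likelihood W i y u (u i) ≤ likelihood W i y u (u i + 1) then
              blockProb W (polarEncode u) y else 0) (fun _ _ => zero_le) hi)
        · simp
    _ = ∑ i ∈ S, bitError W i u := Summable.tsum_finsetSum fun _ _ => ENNReal.summable
    _ ≤ ∑ i ∈ S, ENNReal.ofReal ((1 / 4) ^ n) := by
        refine Finset.sum_le_sum fun i hi => (bitError_le hW i u).trans ?_
        have := hS hi
        simp only [goodSet, Finset.mem_filter, Finset.mem_univ, true_and] at this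
        exact ENNReal.ofReal_le_ofReal this
    _ ≤ ∑ i : Fin (2 ^ n), ENNReal.ofReal ((1 / 4) ^ n) :=
        Finset.sum_le_sum_of_subset (Finset.subset_univ S)
    _ = ENNReal.ofReal ((1 / 2) ^ n) := by
        rw [Finset.sum_const, Finset.card_univ, Fintype.card_fin, nsmul_eq_mul,
          ← ENNReal.ofReal_natCast, ← ENNReal.ofReal_mul (by positivity)]
        push_cast
        rw [← mul_pow]; norm_num

end Likelihood

/-! ### Sums over the outputs of memoryless channels -/

lemma tsum_pi_prod {α : Type*} : ∀ {m : ℕ} (f : Fin m → α → ℝ≥0∞),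
    ∑' y : Fin m → α, ∏ k, f k (y k) = ∏ k, ∑' a, f k a
  | 0, f => by simp
  | m + 1, f => by
    rw [← (Fin.consEquiv fun _ : Fin (m + 1) => α).tsum_eq, ENNReal.tsum_prod',
      Fin.prod_univ_succ]
    simp only [Fin.consEquiv_apply, Fin.prod_univ_succ, Fin.cons_zero, Fin.cons_succ,
      ENNReal.tsum_mul_left, ENNReal.tsum_mul_right, tsum_pi_prod fun k => f k.succ]

lemma tsum_pi_mul_prod {α : Type*} {m : ℕ} {f : Fin m → α → ℝ≥0∞} (hf : ∀ k, ∑' a, f k a = 1)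
    (k₀ : Fin m) (g : α → ℝ≥0∞) :
    ∑' y : Fin m → α, g (y k₀) * ∏ k, f k (y k) = ∑' a, g a * f k₀ a := by
  have h := tsum_pi_prod fun k a => (if k = k₀ then g a else 1) * f k a
  simp only [Finset.prod_mul_distrib, Finset.prod_ite_eq', Finset.mem_univ,
    if_true] at h
  rw [h, Finset.prod_eq_single k₀ (fun k _ hk => by simp [hk, hf]) (by simp)]
  simp

section Block

variable {n : ℕ} {Y Y' Y₁ Y'' : Type*}

lemma tsum_blockProb (W : Channel Y) (x : Fin (2 ^ n) → ZMod 2) :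
    ∑' y, blockProb W x y = 1 := by
  simp only [blockProb]
  rw [tsum_pi_prod fun j a => W (x j) a]
  simp only [PMF.tsum_coe, Finset.prod_const_one]

lemma RelayChannel.sd_apply (ch : RelayChannel Y' Y₁ Y'') (x : ZMod 2) (y' : Y') :
    ch.sd x y' = ∑' y₁, ch.source x (y', y₁) := by
  classical
  rw [RelayChannel.sd, PMF.map_apply, ENNReal.tsum_prod', tsum_eq_single y']
  · simp
  · intro a ha; simp [ha.symm]

lemma RelayChannel.sr_apply (ch : RelayChannel Y' Y₁ Y'') (x : ZMod 2) (y₁ : Y₁) :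
    ch.sr x y₁ = ∑' y', ch.source x (y', y₁) := by
  classical
  rw [RelayChannel.sr, PMF.map_apply, ENNReal.tsum_prod']
  refine tsum_congr fun y' => ?_
  rw [tsum_eq_single y₁]
  · simp
  · intro a ha; simp [ha.symm]

lemma tsum_blockProb_snd (ch : RelayChannel Y' Y₁ Y'') (x : Fin (2 ^ n) → ZMod 2)
    (y' : Fin (2 ^ n) → Y') :
    ∑' y₁ : Fin (2 ^ n) → Y₁, blockProb ch.source x (fun j => (y' j, y₁ j)) =
      blockProb ch.sd x y' := by
  simp only [blockProb, RelayChannel.sd_apply]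
  exact tsum_pi_prod fun j a => ch.source (x j) (y' j, a)

lemma tsum_blockProb_fst (ch : RelayChannel Y' Y₁ Y'') (x : Fin (2 ^ n) → ZMod 2)
    (y₁ : Fin (2 ^ n) → Y₁) :
    ∑' y' : Fin (2 ^ n) → Y', blockProb ch.source x (fun j => (y' j, y₁ j)) =
      blockProb ch.sr x y₁ := by
  simp only [blockProb, RelayChannel.sr_apply]
  exact tsum_pi_prod fun j a => ch.source (x j) (a, y₁ j)

lemma tsum_source (ch : RelayChannel Y' Y₁ Y'') {m : ℕ} (x : Fin m → Fin (2 ^ n) → ZMod 2)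
    (k₀ : Fin m) (g : (Fin (2 ^ n) → Y') → (Fin (2 ^ n) → Y₁) → ℝ≥0∞) :
    ∑' (y' : Fin m → Fin (2 ^ n) → Y') (y₁ : Fin m → Fin (2 ^ n) → Y₁),
      g (y' k₀) (y₁ k₀) * ∏ k, blockProb ch.source (x k) (fun j => (y' k j, y₁ k j)) =
    ∑' (a' : Fin (2 ^ n) → Y') (a₁ : Fin (2 ^ n) → Y₁),
      g a' a₁ * blockProb ch.source (x k₀) (fun j => (a' j, a₁ j)) := by
  have h := tsum_pi_mul_prod (α := (Fin (2 ^ n) → Y') × (Fin (2 ^ n) → Y₁))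
    (f := fun k a => blockProb ch.source (x k) (fun j => (a.1 j, a.2 j)))
    (fun k => by
      rw [ENNReal.tsum_prod']
      simp only [tsum_blockProb_snd, tsum_blockProb]) k₀ (fun a => g a.1 a.2)
  rw [← (Equiv.arrowProdEquivProdArrow (Fin m) (fun _ => Fin (2 ^ n) → Y')
    fun _ => Fin (2 ^ n) → Y₁).symm.tsum_eq, ENNReal.tsum_prod', ENNReal.tsum_prod'] at h
  exact h

end Block

/-! ### Error probability of the block-Markov scheme -/

namespace NestedCode

variable {n b : ℕ} {Y' Y₁ Y'' : Type*}

lemma sourceBits_castSucc (c : NestedCode n) (m : c.Message b) (k : Fin b) (i : Fin (2 ^ n)) :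
    c.sourceBits m k.castSucc i = if h : i ∈ c.A then m k ⟨i, h⟩ else 0 := by
  rw [sourceBits, Fin.snoc_castSucc]

lemma relayBits_succ (c : NestedCode n) (ch : RelayChannel Y' Y₁ Y'')
    (y₁ : Fin (b + 1) → Fin (2 ^ n) → Y₁) (k : Fin b) :
    c.relayBits ch y₁ k.succ = c.relayForward ch (y₁ k.castSucc) := by
  rw [relayBits, Fin.cons_succ]

lemma destDecode_eq {c : NestedCode n} {ch : RelayChannel Y' Y₁ Y''} {m : c.Message b}
    {y' : Fin (b + 1) → Fin (2 ^ n) → Y'} {y₁ : Fin (b + 1) → Fin (2 ^ n) → Y₁}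
    {y'' : Fin (b + 1) → Fin (2 ^ n) → Y''}
    (hsr : ∀ k : Fin b, ¬ SCFailure ch.sr c.A (c.sourceBits m k.castSucc) (y₁ k.castSucc))
    (hrd : ∀ k : Fin b, ¬ SCFailure ch.rd c.D (c.relayBits ch y₁ k.succ) (y'' k.succ))
    (hsd : ∀ k : Fin b, ¬ SCFailure ch.sd c.B (c.sourceBits m k.castSucc) (y' k.castSucc)) :
    c.destDecode ch y' y'' = m := by
  funext k i
  have h1 : scDecode ch.sr c.A 0 (y₁ k.castSucc) = c.sourceBits m k.castSucc :=
    scDecode_eq (fun i hi => by rw [sourceBits_castSucc, dif_neg hi]; rfl) (hsr k)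
  have h2 : scDecode ch.rd c.D 0 (y'' k.succ) = c.relayBits ch y₁ k.succ :=
    scDecode_eq (fun i hi => by rw [relayBits_succ, relayForward, dif_neg hi]; rfl) (hrd k)
  have h3 : c.destBlock ch (y' k.castSucc) (y'' k.succ) = c.sourceBits m k.castSucc := by
    refine scDecode_eq (fun i hi => ?_) (hsd k)
    by_cases hA : i ∈ c.A
    · have hAB : i ∈ c.A \ c.B := Finset.mem_sdiff.mpr ⟨hA, hi⟩
      -- A correct RD decoding returns what the relay sent, and a correct SR decoding makes that the
      -- true bits: the frozen values for SD are right.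
      rw [dif_pos hAB, h2, relayBits_succ, relayForward, dif_pos (c.relabel ⟨i, hAB⟩).2, h1]
      simp
    · rw [dif_neg fun h => hA (Finset.mem_sdiff.mp h).1, sourceBits_castSucc, dif_neg hA]
  rw [destDecode, h3, sourceBits_castSucc, dif_pos i.2]

lemma outputProb_eq (c : NestedCode n) (ch : RelayChannel Y' Y₁ Y'') (m : c.Message b)
    (y' : Fin (b + 1) → Fin (2 ^ n) → Y') (y₁ : Fin (b + 1) → Fin (2 ^ n) → Y₁)
    (y'' : Fin (b + 1) → Fin (2 ^ n) → Y'') : c.outputProb ch m y' y₁ y'' =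
      (∏ k, blockProb ch.source (polarEncode (c.sourceBits m k)) (fun j => (y' k j, y₁ k j))) *
        ∏ k, blockProb ch.rd (polarEncode (c.relayBits ch y₁ k)) (y'' k) :=
  Finset.prod_mul_distrib

/-- The source's words depend on the message alone. For fixed `y₁` the relay's outputs sum to 1,
although its inputs depend on `y₁`. -/
lemma tsum_mul_outputProb_source (c : NestedCode n) (ch : RelayChannel Y' Y₁ Y'')
    (m : c.Message b) (k₀ : Fin (b + 1))
    (g : (Fin (2 ^ n) → Y') → (Fin (2 ^ n) → Y₁) → ℝ≥0∞) :
    ∑' (y' : Fin (b + 1) → Fin (2 ^ n) → Y') (y₁ : Fin (b + 1) → Fin (2 ^ n) → Y₁)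
      (y'' : Fin (b + 1) → Fin (2 ^ n) → Y''), g (y' k₀) (y₁ k₀) * c.outputProb ch m y' y₁ y'' =
    ∑' (a' : Fin (2 ^ n) → Y') (a₁ : Fin (2 ^ n) → Y₁),
      g a' a₁ * blockProb ch.source (polarEncode (c.sourceBits m k₀)) (fun j => (a' j, a₁ j)) := by
  rw [← tsum_source ch (fun k => polarEncode (c.sourceBits m k)) k₀ g]
  refine tsum_congr fun y' => tsum_congr fun y₁ => ?_
  have h := tsum_pi_prod
    fun k (a : Fin (2 ^ n) → Y'') => blockProb ch.rd (polarEncode (c.relayBits ch y₁ k)) a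
  simp only [tsum_blockProb, Finset.prod_const_one] at h
  simp only [outputProb_eq, ENNReal.tsum_mul_left, h, mul_one]

/-- The relay's word is random and possibly wrong, so the bound is applied conditionally on `y₁`;
hence the hypothesis for every word `u`. -/
lemma tsum_mul_outputProb_relay_le (c : NestedCode n) (ch : RelayChannel Y' Y₁ Y'')
    (m : c.Message b) (k₀ : Fin (b + 1)) {e : ℝ≥0∞}
    (g : (Fin (2 ^ n) → ZMod 2) → (Fin (2 ^ n) → Y'') → ℝ≥0∞)
    (hg : ∀ u, ∑' y'', g u y'' * blockProb ch.rd (polarEncode u) y'' ≤ e) :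
    ∑' (y' : Fin (b + 1) → Fin (2 ^ n) → Y') (y₁ : Fin (b + 1) → Fin (2 ^ n) → Y₁)
      (y'' : Fin (b + 1) → Fin (2 ^ n) → Y''),
        g (c.relayBits ch y₁ k₀) (y'' k₀) * c.outputProb ch m y' y₁ y'' ≤ e := by
  calc _ ≤ ∑' (y' : Fin (b + 1) → Fin (2 ^ n) → Y') (y₁ : Fin (b + 1) → Fin (2 ^ n) → Y₁),
        e * ∏ k, blockProb ch.source (polarEncode (c.sourceBits m k))
          (fun j => (y' k j, y₁ k j)) := by
        refine ENNReal.tsum_le_tsum fun y' => ENNReal.tsum_le_tsum fun y₁ => ?_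
        simp only [outputProb_eq, mul_left_comm (g _ _), ENNReal.tsum_mul_left]
        rw [mul_comm e, tsum_pi_mul_prod
          (f := fun k a => blockProb ch.rd (polarEncode (c.relayBits ch y₁ k)) a)
          (fun k => tsum_blockProb _ _) k₀ (g (c.relayBits ch y₁ k₀))]
        gcongr
        exact hg _
    _ = e := by
        rw [tsum_source ch (fun k => polarEncode (c.sourceBits m k)) k₀ fun _ _ => e]
        simp only [ENNReal.tsum_mul_left, tsum_blockProb_snd, tsum_blockProb, mul_one]

open Classical in
lemma errorProb_le {Y' Y₁ Y'' : Type*} {c : NestedCode n} {ch : RelayChannel Y' Y₁ Y''}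
    (hsd : ch.sd.IsSymmetric) (hsr : ch.sr.IsSymmetric) (hrd : ch.rd.IsSymmetric)
    (hA : c.A ⊆ goodSet n ch.sr) (hB : c.B ⊆ goodSet n ch.sd) (hD : c.D ⊆ goodSet n ch.rd)
    (m : c.Message b) :
    c.errorProb ch m ≤ b * (3 * ENNReal.ofReal ((1 / 2) ^ n)) := by
  let χ (p : Prop) : ℝ≥0∞ := if p then 1 else 0
  let sr (k : Fin b) (a : Fin (2 ^ n) → Y₁) : ℝ≥0∞ :=
    χ (SCFailure ch.sr c.A (c.sourceBits m k.castSucc) a)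
  let sd (k : Fin b) (a : Fin (2 ^ n) → Y') : ℝ≥0∞ :=
    χ (SCFailure ch.sd c.B (c.sourceBits m k.castSucc) a)
  let rd (u : Fin (2 ^ n) → ZMod 2) (a : Fin (2 ^ n) → Y'') : ℝ≥0∞ := χ (SCFailure ch.rd c.D u a)
  have hpt (y' : Fin (b + 1) → Fin (2 ^ n) → Y') (y₁ : Fin (b + 1) → Fin (2 ^ n) → Y₁)
      (y'' : Fin (b + 1) → Fin (2 ^ n) → Y'') :
      (if c.destDecode ch y' y'' ≠ m then c.outputProb ch m y' y₁ y'' else 0) ≤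
        ∑ k : Fin b, (sr k (y₁ k.castSucc) * c.outputProb ch m y' y₁ y'' +
          rd (c.relayBits ch y₁ k.succ) (y'' k.succ) * c.outputProb ch m y' y₁ y'' +
          sd k (y' k.castSucc) * c.outputProb ch m y' y₁ y'') := by
    split_ifs with h
    · have hk : ∃ k : Fin b, SCFailure ch.sr c.A (c.sourceBits m k.castSucc) (y₁ k.castSucc) ∨
          SCFailure ch.rd c.D (c.relayBits ch y₁ k.succ) (y'' k.succ) ∨
          SCFailure ch.sd c.B (c.sourceBits m k.castSucc) (y' k.castSucc) := by
        by_contra! hc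
        exact h (destDecode_eq (fun k => (hc k).1) (fun k => (hc k).2.1) fun k => (hc k).2.2)
      obtain ⟨k, hk⟩ := hk
      refine le_trans ?_ (Finset.single_le_sum (fun _ _ => zero_le) (Finset.mem_univ k))
      simp only [← add_mul]
      refine le_mul_of_one_le_left zero_le ?_
      rcases hk with hk | hk | hk
      · exact le_add_right (le_add_right (by simp [sr, χ, hk]))
      · exact le_add_right (le_add_left (by simp [rd, χ, hk]))
      · exact le_add_left (by simp [sd, χ, hk])
    · exact zero_le
  calc c.errorProb ch m
      ≤ ∑' (y' : Fin (b + 1) → Fin (2 ^ n) → Y') (y₁ : Fin (b + 1) → Fin (2 ^ n) → Y₁)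
        (y'' : Fin (b + 1) → Fin (2 ^ n) → Y''),
        ∑ k : Fin b, (sr k (y₁ k.castSucc) * c.outputProb ch m y' y₁ y'' +
          rd (c.relayBits ch y₁ k.succ) (y'' k.succ) * c.outputProb ch m y' y₁ y'' +
          sd k (y' k.castSucc) * c.outputProb ch m y' y₁ y'') :=
        ENNReal.tsum_le_tsum fun y' => ENNReal.tsum_le_tsum fun y₁ => ENNReal.tsum_le_tsum fun y'' =>
          hpt y' y₁ y''
    _ = ∑ k : Fin b,
        ((∑' (y' : Fin (b + 1) → Fin (2 ^ n) → Y') (y₁ : Fin (b + 1) → Fin (2 ^ n) → Y₁)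
            (y'' : Fin (b + 1) → Fin (2 ^ n) → Y''),
            sr k (y₁ k.castSucc) * c.outputProb ch m y' y₁ y'') +
          (∑' (y' : Fin (b + 1) → Fin (2 ^ n) → Y') (y₁ : Fin (b + 1) → Fin (2 ^ n) → Y₁)
            (y'' : Fin (b + 1) → Fin (2 ^ n) → Y''),
            rd (c.relayBits ch y₁ k.succ) (y'' k.succ) * c.outputProb ch m y' y₁ y'') +
          (∑' (y' : Fin (b + 1) → Fin (2 ^ n) → Y') (y₁ : Fin (b + 1) → Fin (2 ^ n) → Y₁)
            (y'' : Fin (b + 1) → Fin (2 ^ n) → Y''),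
            sd k (y' k.castSucc) * c.outputProb ch m y' y₁ y'')) := by
        simp only [Summable.tsum_finsetSum fun _ _ => ENNReal.summable, ENNReal.tsum_add]
    _ ≤ ∑ k : Fin b, (ENNReal.ofReal ((1 / 2) ^ n) + ENNReal.ofReal ((1 / 2) ^ n) +
          ENNReal.ofReal ((1 / 2) ^ n)) := by
        refine Finset.sum_le_sum fun k _ => add_le_add (add_le_add ?_ ?_) ?_
        · rw [tsum_mul_outputProb_source c ch m k.castSucc fun _ a => sr k a, ENNReal.tsum_comm]
          simp only [ENNReal.tsum_mul_left, tsum_blockProb_fst]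
          exact tsum_scFailure_le hsr hA _
        · exact tsum_mul_outputProb_relay_le c ch m k.succ rd fun u => tsum_scFailure_le hrd hD u
        · rw [tsum_mul_outputProb_source c ch m k.castSucc fun a _ => sd k a]
          simp only [ENNReal.tsum_mul_left, tsum_blockProb_snd]
          exact tsum_scFailure_le hsd hB _
    _ = b * (3 * ENNReal.ofReal ((1 / 2) ^ n)) := by
        rw [Finset.sum_const, Finset.card_univ, Fintype.card_fin, nsmul_eq_mul]
        ring

end NestedCode

/-! ### Capacities -/

section Capacity

variable {Y : Type*}

/-- The output law under the input law `p`, as a real number. -/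
def Channel.outLaw (W : Channel Y) (p : PMF (ZMod 2)) (y : Y) : ℝ :=
  (p 0).toReal * W.real 0 y + (p 1).toReal * W.real 1 y

lemma toReal_bind_apply (W : Channel Y) (p : PMF (ZMod 2)) (y : Y) :
    ((p.bind W) y).toReal = W.outLaw p y := by
  rw [PMF.bind_apply, tsum_fintype, zmod_two_sum, ENNReal.toReal_add, ENNReal.toReal_mul,
    ENNReal.toReal_mul]
  · rfl
  all_goals exact ENNReal.mul_ne_top (PMF.apply_ne_top _ _) (PMF.apply_ne_top _ _)

lemma toReal_zero_add_toReal_one (p : PMF (ZMod 2)) : (p 0).toReal + (p 1).toReal = 1 := by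
  have h := p.tsum_coe
  rw [tsum_fintype, zmod_two_sum] at h
  rw [← ENNReal.toReal_add (p.apply_ne_top _) (p.apply_ne_top _), h, ENNReal.toReal_one]

lemma Channel.hasSum_outLaw (W : Channel Y) (p : PMF (ZMod 2)) : HasSum (W.outLaw p) 1 := by
  have := ((W.hasSum_real 0).mul_left (p 0).toReal).add ((W.hasSum_real 1).mul_left (p 1).toReal)
  rwa [mul_one, mul_one, toReal_zero_add_toReal_one] at this

lemma Channel.mul_real_le_outLaw (W : Channel Y) (p : PMF (ZMod 2)) (x : ZMod 2) (y : Y) :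
    (p x).toReal * W.real x y ≤ W.outLaw p y := by
  have h0 : 0 ≤ (p 0).toReal * W.real 0 y := mul_nonneg ENNReal.toReal_nonneg (W.real_nonneg _ _)
  have h1 : 0 ≤ (p 1).toReal * W.real 1 y := mul_nonneg ENNReal.toReal_nonneg (W.real_nonneg _ _)
  have h01 : ∀ b : ZMod 2, b = 0 ∨ b = 1 := by decide
  unfold Channel.outLaw
  rcases h01 x with rfl | rfl <;> linarith

/-- The ratio pw/q is at most 1, so pw·|log(pw/q)| ≤ q - pw; passing from pw/q to w/q costs log p.
This gives summability over infinite alphabets, where a divergent `tsum` would default to 0. -/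
lemma abs_mul_log_div_le {p w q : ℝ} (hp : 0 ≤ p) (hw : 0 ≤ w) (h : p * w ≤ q) :
    |p * w * Real.log (w / q)| ≤ q + p * w * |Real.log p| := by
  rcases (mul_nonneg hp hw).eq_or_lt with h0 | h0
  · rw [← h0]; simpa using h0.le.trans h
  have hp' : 0 < p := pos_of_mul_pos_left h0 hw
  have hw' : 0 < w := pos_of_mul_pos_right h0 hp
  have hq : 0 < q := h0.trans_le h
  have e : Real.log (w / q) = Real.log (p * w / q) - Real.log p := by
    rw [mul_div_assoc, Real.log_mul hp'.ne' (by positivity)]; ring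
  rw [e, mul_sub]
  refine (abs_sub _ _).trans ?_
  rw [abs_mul (p * w) (Real.log p), abs_of_pos h0]
  gcongr
  have h1 : Real.log (p * w / q) ≤ 0 :=
    Real.log_nonpos (by positivity) ((div_le_one hq).mpr h)
  have h2 := Real.one_sub_inv_le_log_of_pos (x := p * w / q) (by positivity)
  rw [abs_mul, abs_of_pos h0, abs_of_nonpos h1]
  have h3 : p * w * (1 - (p * w / q)⁻¹) ≤ p * w * Real.log (p * w / q) :=
    mul_le_mul_of_nonneg_left h2 h0.le
  have h4 : p * w * (1 - (p * w / q)⁻¹) = p * w - q := by field_simp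
  linarith

lemma Channel.summable_info (W : Channel Y) (p : PMF (ZMod 2)) (x : ZMod 2) :
    Summable fun y => (p x).toReal * W.real x y * Real.logb 2 (W.real x y / W.outLaw p y) := by
  simp only [Real.logb, ← mul_div_assoc]
  refine Summable.div_const ?_ _
  refine Summable.of_norm_bounded
    (g := fun y => W.outLaw p y + (p x).toReal * W.real x y * |Real.log (p x).toReal|)
    ((W.hasSum_outLaw p).summable.add
      (((W.hasSum_real x).summable.mul_left _).mul_right _)) fun y => ?_
  exact abs_mul_log_div_le ENNReal.toReal_nonneg (W.real_nonneg _ _) (W.mul_real_le_outLaw p x y)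

lemma mutualInfo_eq (p : PMF (ZMod 2)) (W : Channel Y) : mutualInfo p W =
    ∑ x, ∑' y, (p x).toReal * W.real x y * Real.logb 2 (W.real x y / W.outLaw p y) := by
  simp only [mutualInfo, toReal_bind_apply, ENNReal.toReal_mul]
  rfl

/-- The uniform law of a bit. -/
abbrev unifBit : PMF (ZMod 2) := PMF.uniformOfFintype (ZMod 2)

lemma unifBit_toReal (x : ZMod 2) : (unifBit x).toReal = 1 / 2 := by
  simp [unifBit, PMF.uniformOfFintype_apply, ZMod.card]

lemma outLaw_unifBit (W : Channel Y) (y : Y) :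
    W.outLaw unifBit y = (W.real 0 y + W.real 1 y) / 2 := by
  rw [Channel.outLaw, unifBit_toReal, unifBit_toReal]; ring

lemma mutualInfo_unifBit (W : Channel Y) : mutualInfo unifBit W = W.symInfo := by
  rw [mutualInfo_eq, zmod_two_sum,
    ← (W.summable_info unifBit 0).tsum_add (W.summable_info unifBit 1), Channel.symInfo]
  refine tsum_congr fun y => ?_
  rw [infoTerm, unifBit_toReal, unifBit_toReal, outLaw_unifBit]
  have e (a s : ℝ) : a / (s / 2) = 2 * a / s := by rw [div_div_eq_mul_div, mul_comm]
  rw [e, e]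
  ring

/-- The divergence of the output law for the input `x` from that for the uniform input. -/
def Channel.divergence (W : Channel Y) (x : ZMod 2) : ℝ :=
  ∑' y, W.real x y * Real.logb 2 (W.real x y / W.outLaw unifBit y)

lemma Channel.hasSum_divergence (W : Channel Y) (x : ZMod 2) :
    HasSum (fun y => W.real x y * Real.logb 2 (W.real x y / W.outLaw unifBit y))
      (W.divergence x) := by
  refine Summable.hasSum ?_
  have h := (W.summable_info unifBit x).mul_left 2
  simp only [unifBit_toReal] at h
  refine h.congr fun y => ?_
  ring

lemma symInfo_eq_divergence (W : Channel Y) :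
    W.symInfo = (W.divergence 0 + W.divergence 1) / 2 := by
  rw [← mutualInfo_unifBit, mutualInfo_eq, zmod_two_sum]
  simp only [unifBit_toReal, mul_assoc, tsum_mul_left, Channel.divergence]
  ring

lemma divergence_eq_symInfo {W : Channel Y} (hW : W.IsSymmetric) (x : ZMod 2) :
    W.divergence x = W.symInfo := by
  have h : W.divergence 1 = W.divergence 0 := by
    obtain ⟨π, hπ, hW⟩ := hW
    have h1 (y : Y) : W.real 1 y = W.real 0 (π y) := by rw [Channel.real, hW]; rfl
    have h0 (y : Y) : W.real 0 y = W.real 1 (π y) := by rw [h1, hπ]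
    rw [Channel.divergence, Channel.divergence, ← π.tsum_eq]
    refine tsum_congr fun y => ?_
    rw [outLaw_unifBit, outLaw_unifBit, ← h0, ← h1, add_comm]
  have h' := symInfo_eq_divergence W
  have h01 : ∀ b : ZMod 2, b = 0 ∨ b = 1 := by decide
  rcases h01 x with rfl | rfl <;> linarith

/-- The difference of the two sides is the divergence of the output law under `p` from that under
the uniform input, which is nonnegative. -/
lemma mutualInfo_le_divergence (p : PMF (ZMod 2)) (W : Channel Y) :
    mutualInfo p W ≤ (p 0).toReal * W.divergence 0 + (p 1).toReal * W.divergence 1 := by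
  have hl : 0 < Real.log 2 := Real.log_pos one_lt_two
  have hL := (W.summable_info p 0).hasSum.add (W.summable_info p 1).hasSum
  -- The last summand has total 0. It makes the comparison hold output by output, through q - r ≤ q
  -- log(q/r).
  have hR := (((W.hasSum_divergence 0).mul_left (p 0).toReal).add
    ((W.hasSum_divergence 1).mul_left (p 1).toReal)).add
    (((W.hasSum_outLaw unifBit).sub (W.hasSum_outLaw p)).div_const (Real.log 2))
  rw [mutualInfo_eq, zmod_two_sum]
  refine (hasSum_le (fun y => ?_) hL hR).trans (le_of_eq (by ring))
  have hp0 : 0 ≤ (p 0).toReal := ENNReal.toReal_nonneg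
  have hp1 : 0 ≤ (p 1).toReal := ENNReal.toReal_nonneg
  have hw0 := W.real_nonneg 0 y
  have hw1 := W.real_nonneg 1 y
  have hu := outLaw_unifBit W y
  have hq : W.outLaw p y = (p 0).toReal * W.real 0 y + (p 1).toReal * W.real 1 y := rfl
  have hr0 : 0 ≤ W.outLaw unifBit y := by rw [hu]; positivity
  have hq0 : 0 ≤ W.outLaw p y := by rw [hq]; positivity
  have key (w c : ℝ) (hc : 0 ≤ c) (hw : 0 ≤ w) (hwr : w ≤ 2 * W.outLaw unifBit y)
      (hwq : c * w ≤ W.outLaw p y) :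
      c * w * Real.log (w / W.outLaw p y) = c * w * Real.log (w / W.outLaw unifBit y) -
        c * w * Real.log (W.outLaw p y / W.outLaw unifBit y) := by
    rcases (mul_nonneg hc hw).eq_or_lt with h0 | h0
    · rw [← h0]; simp
    have hw' : 0 < w := pos_of_mul_pos_right h0 hc
    have hqp : 0 < W.outLaw p y := h0.trans_le hwq
    have hrp : 0 < W.outLaw unifBit y := by linarith
    rw [Real.log_div hw'.ne' hqp.ne', Real.log_div hw'.ne' hrp.ne', Real.log_div hqp.ne' hrp.ne']
    ring
  have h0 := key (W.real 0 y) (p 0).toReal hp0 hw0 (by linarith) (W.mul_real_le_outLaw p 0 y)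
  have h1 := key (W.real 1 y) (p 1).toReal hp1 hw1 (by linarith) (W.mul_real_le_outLaw p 1 y)
  have hgibbs : W.outLaw p y - W.outLaw unifBit y ≤
      W.outLaw p y * Real.log (W.outLaw p y / W.outLaw unifBit y) := by
    rcases hq0.eq_or_lt with hz | hz
    · rw [← hz]; simpa using hr0
    rcases hr0.eq_or_lt with hr | hr
    · exfalso
      have e0 : W.real 0 y = 0 := by linarith
      have e1 : W.real 1 y = 0 := by linarith
      rw [hq, e0, e1] at hz; simp at hz
    have := mul_le_mul_of_nonneg_left (Real.one_sub_inv_le_log_of_pos (div_pos hz hr)) hz.le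
    refine le_trans (le_of_eq ?_) this
    field_simp
  simp only [Real.logb, ← mul_div_assoc, ← add_div]
  rw [div_le_div_iff_of_pos_right hl, h0, h1, ← mul_assoc, ← mul_assoc]
  have : W.outLaw p y * Real.log (W.outLaw p y / W.outLaw unifBit y) =
      (p 0).toReal * W.real 0 y * Real.log (W.outLaw p y / W.outLaw unifBit y) +
      (p 1).toReal * W.real 1 y * Real.log (W.outLaw p y / W.outLaw unifBit y) := by
    rw [← add_mul, ← hq]
  linarith

lemma mutualInfo_le_symInfo {W : Channel Y} (hW : W.IsSymmetric) (p : PMF (ZMod 2)) :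
    mutualInfo p W ≤ W.symInfo := by
  refine (mutualInfo_le_divergence p W).trans (le_of_eq ?_)
  rw [divergence_eq_symInfo hW, divergence_eq_symInfo hW, ← add_mul, toReal_zero_add_toReal_one,
    one_mul]

/-- The uniform input achieves the capacity of a symmetric channel. -/
theorem capacity_eq_symInfo {W : Channel Y} (hW : W.IsSymmetric) : W.capacity = W.symInfo := by
  refine le_antisymm (ciSup_le (mutualInfo_le_symInfo hW)) ?_
  rw [← mutualInfo_unifBit]
  exact le_ciSup (f := fun p => mutualInfo p W)
    ⟨W.symInfo, by rintro _ ⟨p, rfl⟩; exact mutualInfo_le_symInfo hW p⟩ unifBit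

lemma hasSum_mul_pmf {α β : Type*} {f : α → ℝ} (hf : Summable f) (Q : α → PMF β) :
    HasSum (fun z : α × β => f z.1 * (Q z.1 z.2).toReal) (∑' a, f a) := by
  have hQ (a : α) : HasSum (fun b => (Q a b).toReal) 1 :=
    Channel.hasSum_real (fun _ : ZMod 2 => Q a) 0
  have hs : Summable fun z : α × β => f z.1 * (Q z.1 z.2).toReal := by
    refine Summable.of_norm ?_
    rw [summable_prod_of_nonneg fun _ => norm_nonneg _]
    have e (a : α) : HasSum (fun b => ‖f a * (Q a b).toReal‖) ‖f a‖ := by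
      simp only [norm_mul, Real.norm_of_nonneg ENNReal.toReal_nonneg]
      simpa using (hQ a).mul_left ‖f a‖
    exact ⟨fun a => (e a).summable, by simpa only [(e _).tsum_eq] using hf.norm⟩
  have := hs.hasSum.prod_fiberwise fun a => (hQ a).mul_left (f a)
  simp only [mul_one] at this
  rw [this.tsum_eq]
  exact hs.hasSum

end Capacity

section RelayCapacity

variable {Y' Y₁ Y'' : Type*} {ch : RelayChannel Y' Y₁ Y''}

lemma RelayChannel.IsPhysicallyDegraded.isDegradedOf (h : ch.IsPhysicallyDegraded) :
    ch.sd.IsDegradedOf ch.sr := by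
  obtain ⟨Q, hQ⟩ := h
  refine ⟨Q, fun x => PMF.ext fun y' => ?_⟩
  rw [RelayChannel.sd_apply, PMF.bind_apply]
  exact tsum_congr fun y₁ => hQ x y' y₁

/-- The factor `Q y₁ y'` cancels inside the logarithm and sums to 1 outside it. -/
lemma mutualInfo_source (h : ch.IsPhysicallyDegraded) (p : PMF (ZMod 2)) :
    mutualInfo p ch.source = mutualInfo p ch.sr := by
  obtain ⟨Q, hQ⟩ := h
  have hr (x : ZMod 2) (y' : Y') (y₁ : Y₁) :
      ch.source.real x (y', y₁) = ch.sr.real x y₁ * (Q y₁ y').toReal := by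
    rw [Channel.real, hQ, ENNReal.toReal_mul]; rfl
  have ho (y' : Y') (y₁ : Y₁) :
      ch.source.outLaw p (y', y₁) = ch.sr.outLaw p y₁ * (Q y₁ y').toReal := by
    rw [Channel.outLaw, Channel.outLaw, hr, hr]; ring
  rw [mutualInfo_eq, mutualInfo_eq]
  refine Finset.sum_congr rfl fun x _ => ?_
  have hs := hasSum_mul_pmf (ch.sr.summable_info p x) Q
  rw [← (Equiv.prodComm Y₁ Y').tsum_eq, ← hs.tsum_eq]
  refine tsum_congr fun z => ?_
  obtain ⟨y₁, y'⟩ := z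
  simp only [Equiv.prodComm_apply, Prod.swap_prod_mk, hr, ho]
  rcases eq_or_ne (Q y₁ y').toReal 0 with h0 | h0
  · simp [h0]
  · rw [mul_div_mul_right _ _ h0]; ring

/-- The capacity of a physically degraded receiver-orthogonal relay channel with symmetric
component channels. -/
theorem relayCapacity_eq (hdeg : ch.IsPhysicallyDegraded)
    (hsd : ch.sd.IsSymmetric) (hsr : ch.sr.IsSymmetric) (hrd : ch.rd.IsSymmetric) :
    ch.capacity = min (ch.sd.symInfo + ch.rd.symInfo) ch.sr.symInfo := by
  have hle (q : PMF (ZMod 2) × PMF (ZMod 2)) :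
      min (mutualInfo q.1 ch.sd + mutualInfo q.2 ch.rd) (mutualInfo q.1 ch.source) ≤
        min (ch.sd.symInfo + ch.rd.symInfo) ch.sr.symInfo := by
    rw [mutualInfo_source hdeg]
    exact min_le_min (add_le_add (mutualInfo_le_symInfo hsd _) (mutualInfo_le_symInfo hrd _))
      (mutualInfo_le_symInfo hsr _)
  refine le_antisymm (ciSup_le hle) ?_
  have := le_ciSup (f := fun q : PMF (ZMod 2) × PMF (ZMod 2) =>
    min (mutualInfo q.1 ch.sd + mutualInfo q.2 ch.rd) (mutualInfo q.1 ch.source))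
    ⟨_, by rintro _ ⟨q, rfl⟩; exact hle q⟩ (unifBit, unifBit)
  rwa [mutualInfo_source hdeg, mutualInfo_unifBit, mutualInfo_unifBit, mutualInfo_unifBit] at this

end RelayCapacity

/-! ### The choice of the codes -/

section Codes

/-- With `B` = `G₁`, the size of `A` is the largest for which `A` fits in `G₂` and `A \ B` has room
in `G₃`. -/
lemma exists_nestedCode {n : ℕ} {G₁ G₂ G₃ : Finset (Fin (2 ^ n))} (h : G₁ ⊆ G₂) :
    ∃ c : NestedCode n, c.A ⊆ G₂ ∧ c.B ⊆ G₁ ∧ c.D ⊆ G₃ ∧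
      c.A.card = min (G₁.card + G₃.card) G₂.card := by
  have hc := Finset.card_le_card h
  obtain ⟨A, hBA, hA, hAc⟩ := Finset.exists_subsuperset_card_eq h
    (n := min (G₁.card + G₃.card) G₂.card) (le_min (Nat.le_add_right _ _) hc) (min_le_right _ _)
  have hd : (A \ G₁).card ≤ G₃.card := by
    rw [Finset.card_sdiff_of_subset hBA]; omega
  obtain ⟨D, hD, hDc⟩ := Finset.exists_subset_card_eq hd
  exact ⟨⟨A, G₁, D, hBA, Finset.equivOfCardEq hDc.symm⟩, hA, subset_rfl, hD, hAc⟩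

end Codes

end PolarRelay

end


/-! ### Choice of the parameters for rate and error -/

theorem theorem2 {Y' Y₁ Y'' : Type*} [Countable Y'] [Countable Y₁] [Countable Y'']
    (ch : PolarRelay.RelayChannel Y' Y₁ Y'')
    (hdeg : ch.IsPhysicallyDegraded)
    (hsd : ch.sd.IsSymmetric) (hsr : ch.sr.IsSymmetric) (hrd : ch.rd.IsSymmetric) :
    ch.capacity = min (ch.sd.capacity + ch.rd.capacity) ch.sr.capacity ∧
    ∀ R : ℝ, R < ch.capacity → ∀ ε : ℝ, 0 < ε →
      ∃ b₀ : ℕ, ∀ b ≥ b₀, ∃ n₀ : ℕ, ∀ n ≥ n₀, ∃ c : PolarRelay.NestedCode n,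
        R ≤ c.rate b ∧ ∀ m : c.Message b, c.errorProb ch m < ENNReal.ofReal ε := by
  open PolarRelay in
  have hcap := relayCapacity_eq hdeg hsd hsr hrd
  refine ⟨by rw [hcap, capacity_eq_symInfo hsd, capacity_eq_symInfo hsr, capacity_eq_symInfo hrd],
    fun R hR ε hε => ?_⟩
  -- Of the gap 4η, at most 2η is lost to incomplete polarization (η each for SD and RD), and 2η
  -- remains to pay for the extra block.
  set η : ℝ := (ch.capacity - R) / 4 with hη
  have hη0 : 0 < η := by linarith
  -- The condition R ≤ 2ηb is equivalent to (b + 1)R ≤ b(R + 2η).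
  obtain ⟨b₀, hb₀⟩ := exists_nat_gt (R / (2 * η))
  rw [div_lt_iff₀ (by linarith)] at hb₀
  refine ⟨b₀, fun b hb => ?_⟩
  obtain ⟨n₁, hn₁⟩ := exists_forall_le_goodFrac ch.sd hη0
  obtain ⟨n₂, hn₂⟩ := exists_forall_le_goodFrac ch.sr hη0
  obtain ⟨n₃, hn₃⟩ := exists_forall_le_goodFrac ch.rd hη0
  have hlim : Filter.Tendsto (fun n : ℕ => (b : ℝ) * (3 * (1 / 2) ^ n)) Filter.atTop (nhds 0) := by
    have h := (tendsto_pow_atTop_nhds_zero_of_lt_one (r := (1 / 2 : ℝ)) (by norm_num)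
      (by norm_num)).const_mul ((b : ℝ) * 3)
    simpa only [mul_zero, mul_assoc] using h
  obtain ⟨n₄, hn₄⟩ := Filter.eventually_atTop.mp (hlim.eventually_lt_const hε)
  refine ⟨max (max n₁ n₂) (max n₃ n₄), fun n hn => ?_⟩
  simp only [ge_iff_le, max_le_iff] at hn
  obtain ⟨c, hA, hB, hD, hcard⟩ := exists_nestedCode (G₃ := goodSet n ch.rd)
    (goodSet_subset_of_isDegradedOf n hdeg.isDegradedOf)
  refine ⟨c, ?_, fun m => ?_⟩
  · have h1 := hn₁ n hn.1.1
    have h2 := hn₂ n hn.1.2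
    have h3 := hn₃ n hn.2.1
    have hpow : (0 : ℝ) < 2 ^ n := by positivity
    have hA' : (2 ^ n : ℝ) * (R + 2 * η) ≤ c.A.card := by
      rw [hcard]
      push_cast
      rw [card_goodSet, card_goodSet, card_goodSet, ← mul_add,
        ← mul_min_of_nonneg _ _ hpow.le]
      gcongr
      have hC : ch.capacity = R + 4 * η := by rw [hη]; ring
      rw [hcap] at hC
      have hC1 := min_le_left (ch.sd.symInfo + ch.rd.symInfo) ch.sr.symInfo
      have hC2 := min_le_right (ch.sd.symInfo + ch.rd.symInfo) ch.sr.symInfo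
      exact le_min (by linarith) (by linarith)
    rw [NestedCode.rate, le_div_iff₀ (by positivity)]
    have hb' : (b₀ : ℝ) ≤ b := by exact_mod_cast hb
    have hR' : R ≤ b * (2 * η) := hb₀.le.trans (by gcongr)
    calc R * ((b + 1) * 2 ^ n) = 2 ^ n * (b * R + R) := by ring
      _ ≤ 2 ^ n * (b * R + b * (2 * η)) := by gcongr
      _ = b * (2 ^ n * (R + 2 * η)) := by ring
      _ ≤ b * c.A.card := by gcongr
  · refine (NestedCode.errorProb_le hsd hsr hrd hA hB hD m).trans_lt ?_
    have e : (b : ENNReal) * (3 * ENNReal.ofReal ((1 / 2) ^ n)) =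
        ENNReal.ofReal (b * (3 * (1 / 2) ^ n)) := by
      rw [ENNReal.ofReal_mul (by positivity), ENNReal.ofReal_mul (by norm_num),
        ENNReal.ofReal_natCast, ENNReal.ofReal_ofNat]
    rw [e]
    exact (ENNReal.ofReal_lt_ofReal_iff hε).mpr (hn₄ n hn.2.2)
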